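/- Let $c\ge 1$ be an integer. In the LOCAL model, the vertices of a finite simple graph $G=(V,E)$ on $n$ vertices are processors that communicate along the edges in synchronous rounds, with unbounded messages and unbounded local computation; initially each vertex knows only $n$ and its own identifier, the identifiers being distinct elements of $\{1,\dots,n^{c}\}$ (the ports of each vertex are numbered arbitrarily). Call a simple cycle $C$ in a graph $H$ removable if the induced subgraph $H[V(C)]$ is neither isomorphic to a complete graph nor to a cycle graph of odd length; its degree in $H$ is the maximum degree in $H$ of its vertices. Given $G$, define sets of active vertices by $A_0=V$ and, for $i\ge 0$: $U_i$ is the set of those vertices of $A_i$ that lie on no removable cycle of length $4$ and degree at most $4$ of $G[A_i]$, and $A_{i+1}$ is the set of those vertices of $U_i$ whose degree in $G[U_i]$ is at least $4$. There are a deterministic LOCAL algorithm $\mathcal A$ and a function $T:\mathbb N\to\mathbb N$ with $T(n)=O(\log n)$ (both may depend on $c$) such that for every triangle-free planar graph $G$ on $n$ vertices the following hold. 1. $|A_{i+1}|\le 0.99\,|A_i|$ for every $i\ge 0$, and $A_\beta=\emptyset$ for $\beta = 1+70\lceil\log_2 n\rceil$. 2. For every assignment of distinct identifiers from $\{1,\dots,n^{c}\}$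 and every port numbering, after $T(n)$ communication rounds of $\mathcal A$ each vertex $v$ outputs a label $L(v)$ and a color $C(v)\in\{1,2,3,4\}$ such that $C$ is a proper coloring of $G$, and $L(v)$ tells the iteration and the step in which $v$ is removed, i.e. the index $i$ with $v\in A_i\setminus A_{i+1}$ and whether $v\in A_i\setminus U_i$ or $v\in U_i\setminus A_{i+1}$. -/

import Mathlib

open Filter Asymptotics

/-! ### Planar graphs -/

/-- `S` is a simple polygonal arc in the plane from `a` to `b`: it is the union of the consecutive
line segments of a polygonal line `p 0 = a, p 1, …, p (m + 1) = b` that does not meet itself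
(two consecutive segments share only their common end point, all other pairs are disjoint). -/
def IsPolygonalArc (a b : ℝ × ℝ) (S : Set (ℝ × ℝ)) : Prop :=
  ∃ (m : ℕ) (p : ℕ → ℝ × ℝ), p 0 = a ∧ p (m + 1) = b ∧
    (∀ i ≤ m, p i ≠ p (i + 1)) ∧
    (∀ i j, i < j → j ≤ m →
      segment ℝ (p i) (p (i + 1)) ∩ segment ℝ (p j) (p (j + 1)) ⊆ {x | j = i + 1 ∧ x = p j}) ∧
    S = ⋃ i ∈ Set.Iic m, segment ℝ (p i) (p (i + 1))

namespace SimpleGraph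

variable {V : Type*}

/-- A graph is planar if it can be drawn in the plane: its vertices are distinct points, each edge
is a polygonal arc joining its two ends and passing through no other vertex, and two different edges
meet at most in common end vertices. -/
def IsPlanar (G : SimpleGraph V) : Prop :=
  ∃ (pos : V → ℝ × ℝ) (arc : Sym2 V → Set (ℝ × ℝ)),
    Function.Injective pos ∧
    (∀ u v, G.Adj u v → IsPolygonalArc (pos u) (pos v) (arc s(u, v))) ∧
    (∀ e ∈ G.edgeSet, ∀ w, pos w ∈ arc e → w ∈ e) ∧
    (∀ e ∈ G.edgeSet, ∀ f ∈ G.edgeSet, e ≠ f →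
      arc e ∩ arc f ⊆ pos '' {w | w ∈ e ∧ w ∈ f})

/-! ### Removable cycles and the peeling process -/

/-- The vertex set of a closed walk. -/
def cycleVerts {H : SimpleGraph V} {u : V} (C : H.Walk u u) : Set V := {w | w ∈ C.support}

/-- A simple cycle `C` of `H` is removable if the subgraph of `H` induced by its vertices is neither
a complete graph nor isomorphic to a cycle graph of odd length. -/
def IsRemovable {H : SimpleGraph V} {u : V} (C : H.Walk u u) : Prop :=
  C.IsCycle ∧ H.induce (cycleVerts C) ≠ ⊤ ∧
    ¬ ∃ k : ℕ, Odd k ∧ Nonempty (H.induce (cycleVerts C) ≃g cycleGraph k)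

/-- The vertices of `H` that lie on a removable cycle of length `4` all of whose vertices have
degree at most `4` in `H`. -/
def onRemovableFourCycle (H : SimpleGraph V) : Set V :=
  {v | ∃ (u : V) (C : H.Walk u u), IsRemovable C ∧ C.length = 4 ∧
    (∀ w ∈ cycleVerts C, (H.neighborSet w).ncard ≤ 4) ∧ v ∈ cycleVerts C}

/-- First step of an iteration with set `A` of active vertices: remove all vertices that lie on a
removable cycle of length `4` and degree at most `4` of the induced graph `G[A]`. -/
def afterStepOne (G : SimpleGraph V) (A : Set V) : Set V :=
  A \ (Subtype.val '' onRemovableFourCycle (G.induce A))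

/-- Second step of an iteration with set `U` of active vertices: remove all vertices of degree less
than `4` in the induced graph `G[U]`. -/
def afterStepTwo (G : SimpleGraph V) (U : Set V) : Set V :=
  U \ (Subtype.val '' {v : U | ((G.induce U).neighborSet v).ncard < 4})

/-- The active vertices after `i` iterations; initially all vertices are active. -/
def activeSet (G : SimpleGraph V) : ℕ → Set V
  | 0 => Set.univ
  | i + 1 => afterStepTwo G (afterStepOne G (activeSet G i))

/-- `layer G (i, j)` is the set of the vertices removed in iteration `i + 1`,
in its first step if `j = 0` and in its second step if `j = 1`. -/
def layer (G : SimpleGraph V) (l : ℕ × Fin 2) : Set V :=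
  if l.2 = 0 then activeSet G l.1 \ afterStepOne G (activeSet G l.1)
  else afterStepOne G (activeSet G l.1) \ activeSet G (l.1 + 1)

end SimpleGraph

/-- The number `1 + 70 ⌈log₂ n⌉` of iterations of the peeling process. -/
noncomputable def numIterations (n : ℕ) : ℕ := 1 + 70 * ⌈Real.logb 2 n⌉₊

/-! ### The LOCAL model -/

/-- A port numbering: every vertex numbers the edges at it by `0, …, degree - 1`. -/
def PortNumbering {V : Type*} [Fintype V] (G : SimpleGraph V) [DecidableRel G.Adj] : Type _ :=
  ∀ v : V, Fin (G.degree v) ≃ G.neighborSet v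

/-- A deterministic algorithm in the LOCAL model, executed by every vertex of a network. Messages
and local computation are unrestricted. -/
structure LocalAlgorithm (Out : Type) where
  /-- local states of a vertex -/
  State : Type
  /-- messages -/
  Msg : Type
  /-- the initial state, from the number `n` of vertices and the identifier of the vertex only -/
  init : (n : ℕ) → (ident : ℕ) → State
  /-- the message, if any, that is sent in a round through the port with the given number -/
  send : State → (port : ℕ) → Option Msg
  /-- the new state, from the old one and the messages that arrive, listed by port number -/
  step : State → List (Option Msg) → State
  /-- the output that is read off from a state -/
  output : State → Out

namespace LocalAlgorithm

variable {Out : Type} {V : Type*} [Fintype V]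

/-- The state of each vertex after `t` synchronous communication rounds: in each round the message
that `v` gets through a port comes from the neighbour `u` at the other end of the edge, which sent
it through its own port for that edge. -/
def stateAfter (A : LocalAlgorithm Out) (G : SimpleGraph V) [DecidableRel G.Adj]
    (ident : V → ℕ) (ports : PortNumbering G) : ℕ → V → A.State
  | 0, v => A.init (Fintype.card V) (ident v)
  | t + 1, v => A.step (A.stateAfter G ident ports t v)
      (List.ofFn fun i : Fin (G.degree v) =>
        A.send (A.stateAfter G ident ports t (ports v i))
          ((ports (ports v i)).symm ⟨v, SimpleGraph.Adj.symm (ports v i).2⟩))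

/-- The output of each vertex after `t` communication rounds. -/
def outputAfter (A : LocalAlgorithm Out) (G : SimpleGraph V) [DecidableRel G.Adj]
    (ident : V → ℕ) (ports : PortNumbering G) (t : ℕ) (v : V) : Out :=
  A.output (A.stateAfter G ident ports t v)

end LocalAlgorithm

open scoped Topology

/-! ### Counting faces by circulations -/


/-! Sparsity drives the peeling. A triangle-free planar graph has average degree at most 4, and one
without four-cycles as well has average degree at most 10/3. Suppose an iteration removed few
vertices of the active set `A`. Survivors have degree at least 4, so the average bound forces the
total excess over 4, and hence the number of edges at vertices of degree at least 5, to be small.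
The remaining vertices of degree at most 4 that lie on no light four-cycle induce a graph of girth
at least 5, whose average degree is at most 10/3, although almost all of its vertices keep almost
all of about 4 edges. Quantitatively, at least one vertex in 78 is removed
(`card_le_mul_card_removed`), which gives the factor 0.99 and logarithmically many iterations.

The density bounds come from the Euler-type inequality g|E| ≤ 2|E| + g|V|
(`SimpleGraph.IsPlanar.card_edgeSet_le`), proved without the Jordan curve theorem. A circulation z
on a polygonal drawing has a logarithmic potential, a weighted winding number. It is locally
constant off the drawing and jumps by 2πi z(e) across the edge e. A face is replaced by a class of
darts on whose left side all these potentials agree. Circulations embed into functions on such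
classes, so there are at least |E| - |V| classes. Walking along a face shows that each class has at
least g darts.

For the colouring, layers are treated from the last removed to the first. Each vertex x has a gadget
inside its layer, either {x} or a light four-cycle through x, that can be recoloured whatever the
colours elsewhere: a vertex with at most three relevant neighbours has a free colour, and a
four-cycle is 2-choosable. Gadgets of one layer interact only within distance five inside the layer,
where degrees are at most 4, so a schedule with constantly many stages per layer separates them.
This schedule is computed by processing the identifiers bit by bit. Each ingredient depends on a
ball of radius O(log n), and the full-information algorithm turns radius into rounds
(`outputAfter_fullInformation`). -/

/-- The boundary operator of a finite directed multigraph. -/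
noncomputable def boundaryMap {V E : Type*} [Fintype E] [DecidableEq V] (src tgt : E → V) :
    (E → ℂ) →ₗ[ℂ] (V → ℂ) where
  toFun z v := ∑ e, z e * ((Pi.single v 1 : V → ℂ) (tgt e) - (Pi.single v 1 : V → ℂ) (src e))
  map_add' z z' := by
    funext v; simp [add_mul, Finset.sum_add_distrib]
  map_smul' r z := by
    funext v; simp [mul_assoc, Finset.mul_sum]

/-- Summation by parts: circulations are orthogonal to gradients. -/
theorem sum_mul_sub_eq_zero_of_boundary {V E : Type*} [Fintype V] [Fintype E] [DecidableEq V]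
    {src tgt : E → V} {z : E → ℂ} (hz : boundaryMap src tgt z = 0) (h : V → ℂ) :
    ∑ e, z e * (h (tgt e) - h (src e)) = 0 := by
  have key : ∀ x, h x = ∑ v, h v * (Pi.single v 1 : V → ℂ) x := by
    intro x
    simp [Pi.single_apply]
  calc ∑ e, z e * (h (tgt e) - h (src e))
      = ∑ e, ∑ v, h v * (z e * ((Pi.single v 1 : V → ℂ) (tgt e)
          - (Pi.single v 1 : V → ℂ) (src e))) := by
        refine Finset.sum_congr rfl fun e _ => ?_
        rw [key (tgt e), key (src e), ← Finset.sum_sub_distrib, Finset.mul_sum]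
        refine Finset.sum_congr rfl fun v _ => by ring
    _ = ∑ v, h v * boundaryMap src tgt z v := by
        rw [Finset.sum_comm]
        refine Finset.sum_congr rfl fun v _ => ?_
        rw [← Finset.mul_sum]; rfl
    _ = 0 := by simp [hz]

/-- If the circulations of a finite directed multigraph have potentials on the darts that are
invariant under a map without short periods, then the graph has few edges. -/
theorem card_edges_le_of_dart_potential {V E : Type*} [Fintype V] [Fintype E] [DecidableEq V]
    (src tgt : E → V) (g : ℕ) (φ : (E → ℂ) →ₗ[ℂ] (E × Bool → ℂ))
    (hjump : ∀ z, φ z = 0 → z = 0) (τ : E × Bool → E × Bool)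
    (hτ : ∀ z, boundaryMap src tgt z = 0 → ∀ d, φ z (τ d) = φ z d)
    (hg : ∀ k, 0 < k → k < g → ∀ d, τ^[k] d ≠ d) :
    g * Fintype.card E ≤ 2 * Fintype.card E + g * Fintype.card V := by
  classical
  let Z := LinearMap.ker (boundaryMap src tgt)
  let κ : E × Bool → (Z → ℂ) := fun d z => φ z.1 d
  -- `F` plays the role of the set of faces: two darts are identified when every circulation has the
  -- same potential at both.
  let F := Finset.univ.image κ
  -- Each fibre of `κ` is closed under `τ`, and the first `g` iterates of any dart are distinct, so
  -- every "face" has at least `g` darts.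
  have hfib : g * F.card ≤ Fintype.card (E × Bool) := by
    rw [← Finset.card_univ, Finset.card_eq_sum_card_image κ, mul_comm]
    refine Finset.card_nsmul_le_sum F _ g ?_
    intro b hb
    obtain ⟨d, -, rfl⟩ := Finset.mem_image.1 hb
    have hit : ∀ k, κ (τ^[k] d) = κ d := by
      intro k
      induction k with
      | zero => rfl
      | succ k ih =>
        rw [Function.iterate_succ_apply', ← ih]
        funext z
        exact hτ z.1 z.2 _
    have hinj : Set.InjOn (fun k => τ^[k] d) (Finset.range g : Set ℕ) := by
      have aux : ∀ i j, i < j → j < g → τ^[i] d ≠ τ^[j] d := by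
        intro i j hij hj he
        refine hg (j - i) (by omega) (by omega) (τ^[i] d) ?_
        rw [← Function.iterate_add_apply, Nat.sub_add_cancel hij.le, he]
      intro i hi j hj he
      simp only [Finset.coe_range, Set.mem_Iio] at hi hj
      rcases lt_trichotomy i j with h | h | h
      · exact absurd he (aux i j h hj)
      · exact h
      · exact absurd he.symm (aux j i h hi)
    calc g = ((Finset.range g).image fun k => τ^[k] d).card := by
          rw [Finset.card_image_of_injOn hinj, Finset.card_range]
      _ ≤ _ := by
          refine Finset.card_le_card ?_
          intro x hx
          obtain ⟨k, -, rfl⟩ := Finset.mem_image.1 hx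
          simpa using hit k
  -- A circulation is determined by its potentials, and these take one value per element of `F`.
  have hdim : Module.finrank ℂ Z ≤ F.card := by
    let L : Z →ₗ[ℂ] (F → ℂ) :=
      { toFun := fun z b => b.1 z
        map_add' := by
          intro z z'
          funext ⟨b, hb⟩
          obtain ⟨d, -, rfl⟩ := Finset.mem_image.1 hb
          simp [κ]
        map_smul' := by
          intro r z
          funext ⟨b, hb⟩
          obtain ⟨d, -, rfl⟩ := Finset.mem_image.1 hb
          simp [κ] }
    have hL : Function.Injective L := by
      rw [← LinearMap.ker_eq_bot, LinearMap.ker_eq_bot']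
      intro z hz
      have : φ z.1 = 0 := by
        funext d
        exact congrFun hz ⟨κ d, Finset.mem_image_of_mem _ (Finset.mem_univ d)⟩
      exact Subtype.ext (hjump _ this)
    simpa using LinearMap.finrank_le_finrank_of_injective hL
  have hrn := LinearMap.finrank_range_add_finrank_ker (boundaryMap src tgt)
  -- The crude bound |V| on the rank, in place of |V| minus the number of components, makes
  -- connectivity irrelevant.
  have hr : Module.finrank ℂ (LinearMap.range (boundaryMap src tgt)) ≤ Fintype.card V := by
    simpa using Submodule.finrank_le (LinearMap.range (boundaryMap src tgt))
  rw [Module.finrank_fintype_fun_eq_card] at hrn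
  have h1 : Fintype.card E ≤ Fintype.card V + F.card := by
    rw [← hrn]; exact add_le_add hr hdim
  rw [Fintype.card_prod, Fintype.card_bool] at hfib
  nlinarith [Nat.mul_le_mul_left g h1]

/-! ### Local constancy of the logarithmic potential -/

theorem IsPreconnected.eq_of_eventually_eq {X Y : Type*} [TopologicalSpace X] {s : Set X}
    (hs : IsPreconnected s) {f : X → Y} (hf : ∀ x ∈ s, ∀ᶠ y in 𝓝[s] x, f y = f x) {x y : X}
    (hx : x ∈ s) (hy : y ∈ s) : f x = f y := by
  let _ : TopologicalSpace Y := ⊥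
  have _ : DiscreteTopology Y := ⟨rfl⟩
  refine hs.constant (f := f) (fun a ha => ?_) hx hy
  unfold ContinuousWithinAt
  rw [nhds_discrete, tendsto_pure]
  exact hf a ha

/-- The logarithmic potential of a line segment. -/
noncomputable def segLog (a b p : ℂ) : ℂ := Complex.log ((b - p) / (a - p))

/-- If the ratio were -t with t ≥ 0, then p would be the convex combination of a and b with weights
t/(1+t) and 1/(1+t). So the branch cut of `segLog a b` is exactly the segment. -/
theorem div_mem_slitPlane_of_notMem_segment {a b p : ℂ} (hp : p ∉ segment ℝ a b) :
    (b - p) / (a - p) ∈ Complex.slitPlane := by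
  by_contra h
  rw [Complex.mem_slitPlane_iff, not_or, not_lt, not_not] at h
  obtain ⟨h1, h2⟩ := h
  have ha : a - p ≠ 0 := fun h0 => hp (by rw [← sub_eq_zero.1 h0]; exact left_mem_segment ℝ a b)
  obtain ⟨t, ht0, ht⟩ : ∃ t : ℝ, 0 ≤ t ∧ (b - p) / (a - p) = -(t : ℂ) :=
    ⟨-((b - p) / (a - p)).re, by linarith, by apply Complex.ext <;> simp [h2]⟩
  rw [div_eq_iff ha] at ht
  apply hp
  have h3 : (0 : ℝ) < 1 + t := by linarith
  have h3' : (1 + t : ℂ) ≠ 0 := by exact_mod_cast h3.ne'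
  refine ⟨t / (1 + t), 1 / (1 + t), by positivity, by positivity, by field_simp; ring, ?_⟩
  simp only [Complex.real_smul]
  push_cast
  field_simp
  linear_combination ht

theorem div_eq_neg_of_mem_openSegment {a b p : ℂ} (hab : a ≠ b) (hp : p ∈ openSegment ℝ a b) :
    a - p ≠ 0 ∧ b - p ≠ 0 ∧ ∃ t : ℝ, 0 < t ∧ (b - p) / (a - p) = -(t : ℂ) := by
  obtain ⟨x, y, hx, hy, hxy, rfl⟩ := hp
  have hy' : (y : ℂ) = 1 - x := by rw [eq_sub_iff_add_eq', ← Complex.ofReal_add, hxy, Complex.ofReal_one]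
  have hx0 : (x : ℂ) ≠ 0 := by exact_mod_cast hx.ne'
  have hy0 : (y : ℂ) ≠ 0 := by exact_mod_cast hy.ne'
  have hba : b - a ≠ 0 := sub_ne_zero.2 hab.symm
  have h1 : a - (x • a + y • b) = -y * (b - a) := by
    simp only [Complex.real_smul]; rw [hy']; ring
  have h2 : b - (x • a + y • b) = x * (b - a) := by
    simp only [Complex.real_smul]; rw [hy']; ring
  rw [h1, h2]
  refine ⟨mul_ne_zero (neg_ne_zero.2 hy0) hba, mul_ne_zero hx0 hba, x / y, by positivity, ?_⟩
  push_cast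
  field_simp

theorem hasDerivAt_sub_div_sub {a b p : ℂ} (ha : a - p ≠ 0) :
    HasDerivAt (fun p => (b - p) / (a - p)) ((b - a) / (a - p) ^ 2) p := by
  have := ((hasDerivAt_id p).const_sub b).div ((hasDerivAt_id p).const_sub a) ha
  refine this.congr_deriv ?_
  simp only [id]
  ring

theorem hasDerivAt_segLog {a b p : ℂ} (hp : p ∉ segment ℝ a b) :
    HasDerivAt (segLog a b) (1 / (a - p) - 1 / (b - p)) p := by
  have ha : a - p ≠ 0 := fun h0 => hp (by rw [← sub_eq_zero.1 h0]; exact left_mem_segment ℝ a b)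
  have hb : b - p ≠ 0 := fun h0 => hp (by rw [← sub_eq_zero.1 h0]; exact right_mem_segment ℝ a b)
  have := (hasDerivAt_sub_div_sub (b := b) ha).clog (div_mem_slitPlane_of_notMem_segment hp)
  refine this.congr_deriv ?_
  field_simp
  ring

theorem hasDerivAt_log_neg_sub_div_sub {a b p : ℂ} (ha : a - p ≠ 0) (hb : b - p ≠ 0)
    (hp : -((b - p) / (a - p)) ∈ Complex.slitPlane) :
    HasDerivAt (fun p => Complex.log (-((b - p) / (a - p)))) (1 / (a - p) - 1 / (b - p)) p := by
  have := (hasDerivAt_sub_div_sub (b := b) ha).neg.clog hp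
  refine this.congr_deriv ?_
  dsimp
  field_simp
  ring

theorem log_eq_log_neg_add_of_im_pos {w : ℂ} (hw : 0 < w.im) :
    Complex.log w = Complex.log (-w) + Real.pi * Complex.I := by
  rw [Complex.log, Complex.log, Complex.arg_neg_eq_arg_sub_pi_of_im_pos hw, norm_neg]
  push_cast; ring

theorem log_eq_log_neg_sub_of_im_neg {w : ℂ} (hw : w.im < 0) :
    Complex.log w = Complex.log (-w) - Real.pi * Complex.I := by
  rw [Complex.log, Complex.log, Complex.arg_neg_eq_arg_add_pi_of_im_neg hw, norm_neg]
  push_cast; ring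

theorem log_eq_log_neg_add_of_neg {w : ℂ} (hw : w.re < 0) (hw' : w.im = 0) :
    Complex.log w = Complex.log (-w) + Real.pi * Complex.I := by
  have h : w = -((-w.re : ℝ) : ℂ) := by apply Complex.ext <;> simp [hw']
  rw [h, neg_neg, Complex.log, Complex.log, norm_neg, Complex.arg_ofReal_of_nonneg (by linarith)]
  rw [← Complex.ofReal_neg, Complex.arg_ofReal_of_neg (by linarith)]
  push_cast; ring

/-- The weighted sum of the logarithmic potentials of finitely many line segments. -/
noncomputable def logPotential {ι : Type*} [Fintype ι] (a b w : ι → ℂ) (p : ℂ) : ℂ :=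
  ∑ s, w s * segLog (a s) (b s) p

theorem isClosed_segment (a b : ℂ) : IsClosed (segment ℝ a b) := by
  rw [segment_eq_image_lineMap]
  exact (isCompact_Icc.image (by fun_prop)).isClosed

theorem eventually_eq_of_eventually_hasDerivAt_zero {f : ℂ → ℂ} {x : ℂ}
    (h : ∀ᶠ y in 𝓝 x, HasDerivAt f 0 y) : ∀ᶠ y in 𝓝 x, f y = f x := by
  obtain ⟨ε, hε, hb⟩ := Metric.eventually_nhds_iff_ball.1 h
  refine Metric.eventually_nhds_iff_ball.2 ⟨ε, hε, fun y hy => ?_⟩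
  refine (convex_ball x ε).is_const_of_fderivWithin_eq_zero (𝕜 := ℂ) (f := f)
    (fun z hz => (hb z hz).differentiableAt.differentiableWithinAt) (fun z hz => ?_) hy
    (Metric.mem_ball_self hε)
  rw [fderivWithin_of_isOpen Metric.isOpen_ball hz]
  ext
  simpa using (hb z hz).deriv

theorem eventually_notMem_segments {ι : Type*} [Fintype ι] (a b : ι → ℂ) (P : ι → Prop) {x : ℂ}
    (hx : ∀ s, P s → x ∉ segment ℝ (a s) (b s)) :
    ∀ᶠ y in 𝓝 x, ∀ s, P s → y ∉ segment ℝ (a s) (b s) := by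
  rw [eventually_all]
  intro s
  by_cases hs : P s
  · filter_upwards [(isClosed_segment (a s) (b s)).isOpen_compl.mem_nhds (hx s hs)] with y hy _
    exact hy
  · exact Eventually.of_forall fun y h => absurd h hs

section Potential

variable {ι : Type*} [Fintype ι] {a b w : ι → ℂ}

theorem logPotential_eventually_eq
    (hd : ∀ p, ∑ s, w s * (1 / (a s - p) - 1 / (b s - p)) = 0) {x : ℂ}
    (hx : ∀ s, x ∉ segment ℝ (a s) (b s)) :
    ∀ᶠ y in 𝓝 x, logPotential a b w y = logPotential a b w x := by
  apply eventually_eq_of_eventually_hasDerivAt_zero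
  filter_upwards [eventually_notMem_segments a b (fun _ => True) (fun s _ => hx s)] with y hy
  rw [← hd y]
  exact HasDerivAt.fun_sum fun s _ => (hasDerivAt_segLog (hy s trivial)).const_mul (w s)

/-- Replacing log w by log(-w) in the term of `s₀` makes the sum holomorphic across that segment,
with derivative zero, hence locally constant. The two branches differ by +πi on one side and by -πi
on the other, which gives the jump 2πi. -/
theorem logPotential_near_segment [DecidableEq ι]
    (hd : ∀ p, ∑ s, w s * (1 / (a s - p) - 1 / (b s - p)) = 0) {x : ℂ} (s₀ : ι)
    (hab : a s₀ ≠ b s₀) (hx₀ : x ∈ openSegment ℝ (a s₀) (b s₀))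
    (hx : ∀ s, s ≠ s₀ → x ∉ segment ℝ (a s) (b s)) :
    ∀ᶠ y in 𝓝 x,
      (0 < ((b s₀ - y) / (a s₀ - y)).im → logPotential a b w y = logPotential a b w x) ∧
      (((b s₀ - y) / (a s₀ - y)).im = 0 → logPotential a b w y = logPotential a b w x) ∧
      (((b s₀ - y) / (a s₀ - y)).im < 0 →
        logPotential a b w y = logPotential a b w x - 2 * Real.pi * Complex.I * w s₀) := by
  set f : ℂ → ℂ := fun y => w s₀ * Complex.log (-((b s₀ - y) / (a s₀ - y))) +
    ∑ s ∈ Finset.univ.erase s₀, w s * segLog (a s) (b s) y with hf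
  obtain ⟨ha0, hb0, t, ht, hxt⟩ := div_eq_neg_of_mem_openSegment hab hx₀
  have hcont : ContinuousAt (fun y => (b s₀ - y) / (a s₀ - y)) x :=
    (hasDerivAt_sub_div_sub ha0).continuousAt
  have hre : ∀ᶠ y in 𝓝 x, ((b s₀ - y) / (a s₀ - y)).re < 0 := by
    have := (Complex.continuous_re.continuousAt.comp hcont).eventually_lt
      (continuousAt_const (y := (0 : ℝ)))
    refine this ?_
    simp [hxt, ht]
  have hane : ∀ᶠ y in 𝓝 x, a s₀ - y ≠ 0 :=
    (continuous_const.sub continuous_id).continuousAt.eventually_ne ha0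
  have hbne : ∀ᶠ y in 𝓝 x, b s₀ - y ≠ 0 :=
    (continuous_const.sub continuous_id).continuousAt.eventually_ne hb0
  have hlog : ∀ y, logPotential a b w y = f y + w s₀ *
      (Complex.log ((b s₀ - y) / (a s₀ - y)) - Complex.log (-((b s₀ - y) / (a s₀ - y)))) := by
    intro y
    rw [logPotential, ← Finset.add_sum_erase _ _ (Finset.mem_univ s₀), hf, segLog]
    ring
  have hconst : ∀ᶠ y in 𝓝 x, f y = f x := by
    apply eventually_eq_of_eventually_hasDerivAt_zero
    filter_upwards [eventually_notMem_segments a b (fun s => s ≠ s₀) hx, hre, hane, hbne]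
      with y hy hyre hya hyb
    rw [← hd y, ← Finset.add_sum_erase _ _ (Finset.mem_univ s₀)]
    refine HasDerivAt.add ?_ ?_
    · refine (hasDerivAt_log_neg_sub_div_sub hya hyb ?_).const_mul (w s₀)
      rw [Complex.mem_slitPlane_iff]
      left; simpa using hyre
    · exact HasDerivAt.fun_sum fun s hs =>
        (hasDerivAt_segLog (hy s (Finset.ne_of_mem_erase hs))).const_mul (w s)
  -- On the cut itself `Complex.log` takes the argument π, so the value at a point of the segment is
  -- the value on its left side.
  have hxv : logPotential a b w x = f x + w s₀ * (Real.pi * Complex.I) := by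
    rw [hlog x, log_eq_log_neg_add_of_neg (w := (b s₀ - x) / (a s₀ - x))
      (by simp [hxt, ht]) (by simp [hxt])]
    ring
  filter_upwards [hconst, hre] with y hy hyre
  refine ⟨fun h => ?_, fun h => ?_, fun h => ?_⟩
  · rw [hlog y, hxv, hy, log_eq_log_neg_add_of_im_pos h]; ring
  · rw [hlog y, hxv, hy, log_eq_log_neg_add_of_neg hyre h]; ring
  · rw [hlog y, hxv, hy, log_eq_log_neg_sub_of_im_neg h]; ring

end Potential

/-- `f` has the value `c` on the left side of the line segment from `a` to `b`. -/
def LeftVal (f : ℂ → ℂ) (a b c : ℂ) : Prop :=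
  ∀ x ∈ openSegment ℝ a b, ∀ᶠ y in 𝓝 x, 0 < ((b - y) / (a - y)).im → f y = c

theorem leftVal_logPotential {ι : Type*} [Fintype ι] {a b w : ι → ℂ} [DecidableEq ι]
    (hd : ∀ p, ∑ s, w s * (1 / (a s - p) - 1 / (b s - p)) = 0) (s₀ : ι)
    (hab : a s₀ ≠ b s₀)
    (hs : ∀ s, s ≠ s₀ → Disjoint (openSegment ℝ (a s₀) (b s₀)) (segment ℝ (a s) (b s)))
    {x : ℂ} (hx : x ∈ openSegment ℝ (a s₀) (b s₀)) :
    LeftVal (logPotential a b w) (a s₀) (b s₀) (logPotential a b w x) ∧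
    LeftVal (logPotential a b w) (b s₀) (a s₀)
      (logPotential a b w x - 2 * Real.pi * Complex.I * w s₀) := by
  have near : ∀ y ∈ openSegment ℝ (a s₀) (b s₀), _ := fun y hy =>
    logPotential_near_segment hd s₀ hab hy
      (fun s h => Set.disjoint_left.1 (hs s h) hy)
  have hconst : ∀ y ∈ openSegment ℝ (a s₀) (b s₀),
      logPotential a b w y = logPotential a b w x := by
    intro y hy
    refine (convex_openSegment (𝕜 := ℝ) (a s₀) (b s₀)).isPreconnected.eq_of_eventually_eq
      (fun p hp => ?_) hy hx
    filter_upwards [(near p hp).filter_mono nhdsWithin_le_nhds, self_mem_nhdsWithin] with q hq hqs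
    obtain ⟨-, -, t, -, ht⟩ := div_eq_neg_of_mem_openSegment hab hqs
    exact hq.2.1 (by simp [ht])
  refine ⟨fun y hy => ?_, fun y hy => ?_⟩
  · filter_upwards [near y hy] with q hq h
    rw [hq.1 h, hconst y hy]
  · rw [openSegment_symm] at hy
    filter_upwards [near y hy] with q hq h
    rw [hq.2.2, hconst y hy]
    rw [← inv_div, Complex.inv_im] at h
    by_contra h0
    exact absurd h (not_lt.2 (div_nonpos_of_nonpos_of_nonneg (by linarith) (Complex.normSq_nonneg _)))

theorem LeftVal.unique_along {f : ℂ → ℂ} {a b c c₀ : ℂ} (h : LeftVal f a b c) {x : ℂ}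
    (hx : x ∈ openSegment ℝ a b) {l : Filter ℝ} [l.NeBot] {γ : ℝ → ℂ} (hγ : Tendsto γ l (𝓝 x))
    (hl : ∀ᶠ t in l, 0 < ((b - γ t) / (a - γ t)).im ∧ f (γ t) = c₀) : c = c₀ := by
  obtain ⟨t, h1, h2, h3⟩ := ((hγ.eventually (h x hx)).and hl).exists
  rw [← h3, h1 h2]

/-! ### The cyclic order of segments at a point -/

/-- The range (0, 2π] is chosen so that a reference ray gets the largest angle, 2π, from itself; it
can then be its own successor in the cyclic order only if no other ray is present. -/
theorem exists_angle (w : ℂ) : ∃ θ : ℝ, 0 < θ ∧ θ ≤ 2 * Real.pi ∧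
    w = ‖w‖ * Complex.exp (θ * Complex.I) := by
  rcases le_or_gt w.arg 0 with h | h
  · refine ⟨w.arg + 2 * Real.pi, by linarith [Complex.neg_pi_lt_arg w, Real.pi_pos], by linarith, ?_⟩
    push_cast
    rw [add_mul, Complex.exp_add, Complex.exp_two_pi_mul_I, mul_one, Complex.norm_mul_exp_arg_mul_I]
  · exact ⟨w.arg, h, by linarith [Complex.arg_le_pi w, Real.pi_pos],
      (Complex.norm_mul_exp_arg_mul_I w).symm⟩

theorem angle_unique {r₁ r₂ α β : ℝ} (hr₁ : 0 < r₁) (hr₂ : 0 < r₂) (hα : 0 < α)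
    (hα' : α ≤ 2 * Real.pi) (hβ : 0 < β) (hβ' : β ≤ 2 * Real.pi)
    (h : (r₁ : ℂ) * Complex.exp (α * Complex.I) = r₂ * Complex.exp (β * Complex.I)) : α = β := by
  have hn := congrArg norm h
  rw [norm_mul, norm_mul, Complex.norm_exp_ofReal_mul_I, Complex.norm_exp_ofReal_mul_I,
    Complex.norm_real, Complex.norm_real, Real.norm_of_nonneg hr₁.le, Real.norm_of_nonneg hr₂.le,
    mul_one, mul_one] at hn
  subst hn
  have h2 := mul_left_cancel₀ (by exact_mod_cast hr₁.ne') h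
  obtain ⟨n, hn⟩ := Complex.exp_eq_exp_iff_exists_int.1 h2
  have h3 : α = β + n * (2 * Real.pi) := by
    have := congrArg Complex.im hn
    simpa using this
  have hn1 : (n : ℝ) < 1 := by
    by_contra hc; nlinarith [Real.pi_pos]
  have hn2 : (-1 : ℝ) < n := by
    by_contra hc; nlinarith [Real.pi_pos]
  have : n = 0 := by
    have h1 : n < 1 := by exact_mod_cast hn1
    have h2 : -1 < n := by exact_mod_cast hn2
    omega
  simpa [this] using h3

/-- Near the ray in direction v, the sign of sin t decides on which side of the ray the point at
angle t lies. -/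
theorem im_side {v : ℂ} (hv : v ≠ 0) {r ρ : ℝ} (hr : r ≠ 0) (t : ℝ) :
    ((ρ * v - r * v * Complex.exp (t * Complex.I)) /
      (-(r * v * Complex.exp (t * Complex.I)))).im = ρ / r * Real.sin t := by
  have hr' : (r : ℂ) ≠ 0 := by exact_mod_cast hr
  have he := Complex.exp_ne_zero (t * Complex.I)
  have : (ρ * v - r * v * Complex.exp (t * Complex.I)) /
      (-(r * v * Complex.exp (t * Complex.I)))
      = 1 - ((ρ / r : ℝ) : ℂ) * Complex.exp ((-t : ℝ) * Complex.I) := by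
    push_cast
    rw [neg_mul, Complex.exp_neg]
    field_simp
    ring
  rw [this]
  rw [Complex.sub_im, Complex.one_im, Complex.im_ofReal_mul, Complex.exp_ofReal_mul_I_im,
    Real.sin_neg]
  ring

/-- `j'` is the first germ met when turning counterclockwise from `j`. The open arc of a small
circle between them misses `K`, so `f` is constant on it. Its ends approach the left side of the
outgoing germ `j` and the left side of the incoming germ `j'`. If `j' = j` although another germ
exists, that germ also has angle 2π and overlaps `j`, against disjointness. -/
theorem exists_next_germ {J : Type*} [Finite J] (q : ℂ) (u : J → ℂ) (hu : ∀ j, u j ≠ 0)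
    (hdisj : ∀ i j, i ≠ j → segment ℝ q (q + u i) ∩ segment ℝ q (q + u j) ⊆ {q}) (K : Set ℂ)
    (hK : ∀ᶠ y in 𝓝 q, y ∈ K → ∃ j, y ∈ segment ℝ q (q + u j)) (j : J) :
    ∃ j', ((∃ i, i ≠ j) → j' ≠ j) ∧ ∀ f : ℂ → ℂ, (∀ x ∉ K, ∀ᶠ y in 𝓝 x, f y = f x) →
      ∀ c c', LeftVal f q (q + u j) c → LeftVal f (q + u j') q c' → c = c' := by
  have hnj : (0 : ℝ) < ‖u j‖ := norm_pos_iff.2 (hu j)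
  have hnj' : (‖u j‖ : ℂ) ≠ 0 := by exact_mod_cast hnj.ne'
  obtain ⟨v, hv⟩ : ∃ v, v = u j / ‖u j‖ := ⟨_, rfl⟩
  have hvn : ‖v‖ = 1 := by simp [hv, hnj.ne']
  have hv0 : v ≠ 0 := fun h => by simp [h] at hvn
  have huj : u j = ‖u j‖ * v := by rw [hv]; field_simp
  have hang : ∀ i, ∃ θ : ℝ, 0 < θ ∧ θ ≤ 2 * Real.pi ∧
      u i = ‖u i‖ * v * Complex.exp (θ * Complex.I) := by
    intro i
    obtain ⟨θ, h1, h2, h3⟩ := exists_angle (u i / v)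
    refine ⟨θ, h1, h2, ?_⟩
    rw [norm_div, hvn, div_one, div_eq_iff hv0] at h3
    rw [h3]
    simp only [norm_mul, hvn, Complex.norm_exp_ofReal_mul_I, Complex.norm_real, norm_norm, mul_one]
    ring
  choose θ hθ0 hθ2 hθ using hang
  have : Nonempty J := ⟨j⟩
  obtain ⟨j', hj'⟩ := Finite.exists_min θ
  have hθj : θ j = 2 * Real.pi := by
    refine angle_unique hnj hnj (hθ0 j) (hθ2 j) Real.two_pi_pos le_rfl ?_
    have h1 : (‖u j‖ : ℂ) * v = (‖u j‖ * Complex.exp (θ j * Complex.I)) * v := by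
      conv_lhs => rw [← huj, hθ j]
      ring
    rw [← mul_right_cancel₀ hv0 h1]
    push_cast
    rw [Complex.exp_two_pi_mul_I, mul_one]
  refine ⟨j', ?_, ?_⟩
  · rintro ⟨i, hij⟩ rfl
    have h1 : θ i = 2 * Real.pi := le_antisymm (hθ2 i) (hθj ▸ hj' i)
    have h2 : u i = ‖u i‖ * v := by
      have := hθ i
      rw [h1] at this
      push_cast at this
      rwa [Complex.exp_two_pi_mul_I, mul_one] at this
    have hni : (0 : ℝ) < ‖u i‖ := norm_pos_iff.2 (hu i)
    have hni' : (‖u i‖ : ℂ) ≠ 0 := by exact_mod_cast hni.ne'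
    set s := min ‖u i‖ ‖u j'‖ with hs
    have hs0 : 0 < s := lt_min hni hnj
    have mem : ∀ k, u k = ‖u k‖ * v → 0 < ‖u k‖ → s ≤ ‖u k‖ →
        q + s * v ∈ segment ℝ q (q + u k) := by
      intro k hk hk0 hsk
      have hk0' : (‖u k‖ : ℂ) ≠ 0 := by exact_mod_cast hk0.ne'
      rw [segment_eq_image']
      refine ⟨s / ‖u k‖, ⟨by positivity, by rw [div_le_one hk0]; exact hsk⟩, ?_⟩
      simp only [add_sub_cancel_left, Complex.real_smul, Complex.ofReal_div]
      rw [hk]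
      simp only [norm_mul, hvn, Complex.norm_real, norm_norm, mul_one]
      field_simp
    have := hdisj i j' hij ⟨mem i h2 hni (min_le_left _ _), mem j' huj hnj (min_le_right _ _)⟩
    rw [Set.mem_singleton_iff, add_eq_left] at this
    rcases mul_eq_zero.1 this with h | h
    · exact hs0.ne' (by exact_mod_cast h)
    · exact hv0 h
  · intro f hf c c' hc hc'
    obtain ⟨ε, hε, hb⟩ := Metric.eventually_nhds_iff_ball.1 hK
    obtain ⟨r, ⟨hr1, hr2⟩, hr0⟩ : ∃ r : ℝ, (r < ε ∧ ∀ i, r < ‖u i‖) ∧ 0 < r := by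
      have : ∀ᶠ r : ℝ in 𝓝[>] 0, (r < ε ∧ ∀ i, r < ‖u i‖) ∧ 0 < r := by
        refine (((eventually_lt_nhds hε).filter_mono nhdsWithin_le_nhds).and
          (eventually_all.2 fun i => (eventually_lt_nhds (norm_pos_iff.2 (hu i))).filter_mono
            nhdsWithin_le_nhds)).and self_mem_nhdsWithin
      exact this.exists
    have hr0' : (r : ℂ) ≠ 0 := by exact_mod_cast hr0.ne'
    let γ : ℝ → ℂ := fun t => q + r * v * Complex.exp (t * Complex.I)
    have hγc : Continuous γ := by fun_prop
    have hγK : ∀ t, 0 < t → t < θ j' → γ t ∉ K := by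
      intro t ht0 ht hk
      have hd : γ t ∈ Metric.ball q ε := by
        simp [γ, Complex.norm_exp_ofReal_mul_I, hvn, abs_of_pos hr0, hr1]
      obtain ⟨i, hi⟩ := hb _ hd hk
      rw [segment_eq_image'] at hi
      obtain ⟨s, ⟨hs0, -⟩, hs⟩ := hi
      simp only [add_sub_cancel_left, Complex.real_smul, γ, add_right_inj] at hs
      rw [hθ i] at hs
      have hni : (0 : ℝ) < ‖u i‖ := norm_pos_iff.2 (hu i)
      have h1 : ((s * ‖u i‖ : ℝ) : ℂ) * Complex.exp (θ i * Complex.I)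
          = r * Complex.exp (t * Complex.I) := by
        apply mul_right_cancel₀ hv0
        push_cast
        linear_combination hs
      have hs1 : 0 < s := by
        rcases hs0.lt_or_eq with h | h
        · exact h
        · rw [← h] at h1
          simp [hr0.ne'] at h1
      have := angle_unique (by positivity) hr0 (hθ0 i) (hθ2 i) ht0
        (ht.le.trans (hθ2 j')) h1
      linarith [hj' i]
    have hfc : ∀ t, 0 < t → t < θ j' → f (γ t) = f (γ (θ j' / 2)) := by
      intro t ht0 ht
      have hpos := hθ0 j'
      refine (isPreconnected_Ioo (a := (0 : ℝ)) (b := θ j')).eq_of_eventually_eq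
        (f := fun t => f (γ t)) (fun s hs => ?_) ⟨ht0, ht⟩ ⟨by linarith, by linarith⟩
      exact nhdsWithin_le_nhds (hγc.continuousAt.eventually (hf _ (hγK s hs.1 hs.2)))
    have hmem : ∀ i (e : ℂ), u i = ‖u i‖ * v * e → q + r * v * e ∈ openSegment ℝ q (q + u i) := by
      intro i e h
      have hni : (0 : ℝ) < ‖u i‖ := norm_pos_iff.2 (hu i)
      have hni' : (‖u i‖ : ℂ) ≠ 0 := by exact_mod_cast hni.ne'
      rw [openSegment_eq_image']
      refine ⟨r / ‖u i‖, ⟨by positivity, by rw [div_lt_one hni]; exact hr2 i⟩, ?_⟩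
      simp only [add_sub_cancel_left, Complex.real_smul, Complex.ofReal_div]
      rw [add_right_inj, div_mul_eq_mul_div, div_eq_iff hni']
      conv_lhs => rw [h]
      ring
    have e1 : c = f (γ (θ j' / 2)) := by
      refine hc.unique_along (x := γ 0) (l := 𝓝[>] 0) (γ := γ)
        (hmem j _ (by simpa using huj)) (hγc.continuousAt.tendsto.mono_left nhdsWithin_le_nhds) ?_
      filter_upwards [self_mem_nhdsWithin, nhdsWithin_le_nhds (eventually_lt_nhds (hθ0 j')),
        nhdsWithin_le_nhds (eventually_lt_nhds Real.pi_pos)] with t ht0 ht1 ht2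
      refine ⟨?_, hfc t ht0 ht1⟩
      have h1 := im_side hv0 (ρ := ‖u j‖) hr0.ne' t
      rw [← huj] at h1
      have h2 : q + u j - γ t = u j - r * v * Complex.exp (t * Complex.I) := by simp only [γ]; ring
      have h3 : q - γ t = -(r * v * Complex.exp (t * Complex.I)) := by simp only [γ]; ring
      rw [h2, h3, h1]
      exact mul_pos (by positivity) (Real.sin_pos_of_pos_of_lt_pi ht0 ht2)
    have e2 : c' = f (γ (θ j' / 2)) := by
      have hm := hmem j' _ (hθ j')
      rw [openSegment_symm] at hm
      refine hc'.unique_along (x := γ (θ j')) (l := 𝓝[<] (θ j')) (γ := γ)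
        hm (hγc.continuousAt.tendsto.mono_left nhdsWithin_le_nhds) ?_
      filter_upwards [self_mem_nhdsWithin, nhdsWithin_le_nhds (eventually_gt_nhds (hθ0 j')),
        nhdsWithin_le_nhds (eventually_gt_nhds
          (show θ j' - Real.pi < θ j' by linarith [Real.pi_pos]))] with t ht0 ht1 ht2
      refine ⟨?_, hfc t ht1 ht0⟩
      have ht0' : t < θ j' := ht0
      have hw0 : v * Complex.exp (θ j' * Complex.I) ≠ 0 := mul_ne_zero hv0 (Complex.exp_ne_zero _)
      have h1 := im_side hw0 (ρ := ‖u j'‖) hr0.ne' (t - θ j')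
      have h4 : v * Complex.exp (θ j' * Complex.I) * Complex.exp ((t - θ j' : ℝ) * Complex.I)
          = v * Complex.exp (t * Complex.I) := by
        rw [mul_assoc, ← Complex.exp_add]
        congr 2
        push_cast; ring
      rw [← mul_assoc (‖u j'‖ : ℂ), ← hθ j', mul_assoc (r : ℂ), h4, ← mul_assoc] at h1
      have h2 : q + u j' - γ t = u j' - r * v * Complex.exp (t * Complex.I) := by
        simp only [γ]; ring
      have h3 : q - γ t = -(r * v * Complex.exp (t * Complex.I)) := by simp only [γ]; ring
      rw [h2, h3, ← inv_div, Complex.inv_im, h1]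
      have hs : Real.sin (t - θ j') < 0 :=
        Real.sin_neg_of_neg_of_neg_pi_lt (by linarith) (by linarith)
      have hn : 0 < ‖u j'‖ := norm_pos_iff.2 (hu j')
      have hneg : ‖u j'‖ / r * Real.sin (t - θ j') < 0 := mul_neg_of_pos_of_neg (by positivity) hs
      refine div_pos (by linarith) (Complex.normSq_pos.2 fun h0 => ?_)
      rw [h0] at h1
      simp at h1
      rcases h1 with (h1 | h1) | h1
      · exact hu j' h1
      · exact hr0.ne' h1
      · exact hs.ne h1
    rw [e1, e2]

/-! ### Polygonal drawings in the complex plane -/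

/-- A drawing of a graph in the complex plane: the edge `e`, oriented from `src e` to `tgt e`, is
drawn as the polygonal line through the points `p e 0, …, p e (m e + 1)`. -/
structure SimpleGraph.Drawing {V : Type*} (G : SimpleGraph V) where
  pos : V → ℂ
  src : G.edgeSet → V
  tgt : G.edgeSet → V
  m : G.edgeSet → ℕ
  p : G.edgeSet → ℕ → ℂ
  pos_injective : Function.Injective pos
  edge_eq : ∀ e, e.1 = s(src e, tgt e)
  p_zero : ∀ e, p e 0 = pos (src e)
  p_last : ∀ e, p e (m e + 1) = pos (tgt e)
  p_ne : ∀ e i, i ≤ m e → p e i ≠ p e (i + 1)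
  same_edge : ∀ e i j, i < j → j ≤ m e →
    segment ℝ (p e i) (p e (i + 1)) ∩ segment ℝ (p e j) (p e (j + 1)) ⊆
      {x | j = i + 1 ∧ x = p e j}
  vertex_mem : ∀ e i w, i ≤ m e → pos w ∈ segment ℝ (p e i) (p e (i + 1)) → w ∈ e.1
  diff_edge : ∀ e f, e ≠ f → ∀ i j, i ≤ m e → j ≤ m f →
    segment ℝ (p e i) (p e (i + 1)) ∩ segment ℝ (p f j) (p f (j + 1)) ⊆
      pos '' {w | w ∈ e.1 ∧ w ∈ f.1}

theorem segment_equivRealProd_symm (x y : ℝ × ℝ) :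
    segment ℝ (Complex.equivRealProdLm.symm x) (Complex.equivRealProdLm.symm y) =
      Complex.equivRealProdLm.symm '' segment ℝ x y :=
  (image_segment ℝ (Complex.equivRealProdLm.symm : (ℝ × ℝ) →ₗ[ℝ] ℂ).toAffineMap x y).symm

theorem SimpleGraph.IsPlanar.nonempty_drawing {V : Type*} {G : SimpleGraph V} (h : G.IsPlanar) :
    Nonempty G.Drawing := by
  obtain ⟨pos, arc, hpos, harc, hv, hd⟩ := h
  let κ := Complex.equivRealProdLm.symm
  have hadj : ∀ e : G.edgeSet, G.Adj (Quot.out e.1).1 (Quot.out e.1).2 := by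
    intro e
    rw [← SimpleGraph.mem_edgeSet]
    have : s((Quot.out e.1).1, (Quot.out e.1).2) = e.1 := Quot.out_eq e.1
    rw [this]; exact e.2
  have heq : ∀ e : G.edgeSet, s((Quot.out e.1).1, (Quot.out e.1).2) = e.1 :=
    fun e => Quot.out_eq e.1
  choose m p h0 h1 hne hs hS using fun e : G.edgeSet => harc _ _ (hadj e)
  have hsub : ∀ e i, i ≤ m e → segment ℝ (p e i) (p e (i + 1)) ⊆ arc e.1 := by
    intro e i hi x hx
    rw [← heq e, hS e]
    exact Set.mem_biUnion (show i ∈ Set.Iic (m e) from hi) hx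
  refine ⟨⟨fun v => κ (pos v), fun e => (Quot.out e.1).1, fun e => (Quot.out e.1).2, m,
    fun e i => κ (p e i), κ.injective.comp hpos, fun e => (heq e).symm, fun e => ?_, fun e => ?_,
    fun e i hi h => hne e i hi (κ.injective h), fun e i j hij hj => ?_, fun e i w hi hw => ?_,
    fun e f hef i j hi hj => ?_⟩⟩
  · rw [h0]
  · rw [h1]
  · rw [segment_equivRealProd_symm, segment_equivRealProd_symm,
      ← Set.image_inter κ.injective]
    rintro _ ⟨x, hx, rfl⟩
    obtain ⟨h1, h2⟩ := hs e i j hij hj hx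
    exact ⟨h1, by rw [h2]⟩
  · rw [segment_equivRealProd_symm] at hw
    obtain ⟨x, hx, hxw⟩ := hw
    rw [κ.injective hxw] at hx
    exact hv e.1 e.2 w (hsub e i hi hx)
  · rw [segment_equivRealProd_symm, segment_equivRealProd_symm,
      ← Set.image_inter κ.injective]
    rintro _ ⟨x, hx, rfl⟩
    obtain ⟨w, hw, rfl⟩ := hd e.1 e.2 f.1 f.2 (fun h => hef (Subtype.ext h))
      ⟨hsub e i hi hx.1, hsub f j hj hx.2⟩
    exact ⟨w, hw, rfl⟩

/-! ### Segments and darts of a polygonal drawing. -/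

namespace SimpleGraph.Drawing

variable {V : Type*} {G : SimpleGraph V} (D : G.Drawing)

theorem adj (e : G.edgeSet) : G.Adj (D.src e) (D.tgt e) := by
  rw [← SimpleGraph.mem_edgeSet, ← D.edge_eq]; exact e.2

theorem mem_edge {e : G.edgeSet} {w : V} : w ∈ e.1 ↔ w = D.src e ∨ w = D.tgt e := by
  rw [D.edge_eq e, Sym2.mem_iff]

theorem eq_zero_of_src_mem {e : G.edgeSet} {i : ℕ} (hi : i ≤ D.m e)
    (h : D.pos (D.src e) ∈ segment ℝ (D.p e i) (D.p e (i + 1))) : i = 0 := by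
  rw [← D.p_zero] at h
  by_contra h0
  obtain ⟨h1, h2⟩ := D.same_edge e 0 i (Nat.pos_of_ne_zero h0) hi ⟨left_mem_segment ℝ _ _, h⟩
  rw [h1] at h2
  exact D.p_ne e 0 (Nat.zero_le _) h2

theorem eq_m_of_tgt_mem {e : G.edgeSet} {i : ℕ} (hi : i ≤ D.m e)
    (h : D.pos (D.tgt e) ∈ segment ℝ (D.p e i) (D.p e (i + 1))) : i = D.m e := by
  rw [← D.p_last] at h
  by_contra h0
  obtain ⟨h1, h2⟩ := D.same_edge e i (D.m e) (lt_of_le_of_ne hi h0) le_rfl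
    ⟨h, right_mem_segment ℝ _ _⟩
  exact D.p_ne e (D.m e) le_rfl h2.symm

/-- The line segments of a drawing. -/
abbrev Seg : Type _ := Σ e : G.edgeSet, Fin (D.m e + 1)

/-- The first end of a segment. -/
def A (s : D.Seg) : ℂ := D.p s.1 s.2

/-- The second end of a segment. -/
def B (s : D.Seg) : ℂ := D.p s.1 (s.2 + 1)

theorem A_ne_B (s : D.Seg) : D.A s ≠ D.B s := D.p_ne s.1 s.2 (Nat.lt_succ_iff.1 s.2.2)

theorem endpoint_of_mem_inter {s t : D.Seg} (hst : s ≠ t) {x : ℂ}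
    (hs : x ∈ segment ℝ (D.A s) (D.B s)) (ht : x ∈ segment ℝ (D.A t) (D.B t)) :
    x = D.A s ∨ x = D.B s := by
  obtain ⟨e, i, hi⟩ := s
  obtain ⟨f, j, hj⟩ := t
  by_cases hef : e = f
  · subst hef
    rcases lt_trichotomy i j with h | h | h
    · obtain ⟨h1, h2⟩ := D.same_edge e i j h (Nat.lt_succ_iff.1 hj) ⟨hs, ht⟩
      right; rw [h2, h1]; rfl
    · subst h; exact absurd rfl hst
    · obtain ⟨h1, h2⟩ := D.same_edge e j i h (Nat.lt_succ_iff.1 hi) ⟨ht, hs⟩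
      left; rw [h2]; rfl
  · obtain ⟨w, hw, rfl⟩ := D.diff_edge e f hef i j (Nat.lt_succ_iff.1 hi) (Nat.lt_succ_iff.1 hj)
      ⟨hs, ht⟩
    rcases D.mem_edge.1 hw.1 with rfl | rfl
    · have := D.eq_zero_of_src_mem (Nat.lt_succ_iff.1 hi) hs
      subst this
      left; exact (D.p_zero e).symm
    · have := D.eq_m_of_tgt_mem (Nat.lt_succ_iff.1 hi) hs
      subst this
      right; exact (D.p_last e).symm

theorem eq_of_mem_inter {s t : D.Seg} (hst : s ≠ t) {x y : ℂ}
    (hx : x ∈ segment ℝ (D.A s) (D.B s) ∩ segment ℝ (D.A t) (D.B t))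
    (hy : y ∈ segment ℝ (D.A s) (D.B s) ∩ segment ℝ (D.A t) (D.B t)) : x = y := by
  obtain ⟨e, i, hi⟩ := s
  obtain ⟨f, j, hj⟩ := t
  by_cases hef : e = f
  · subst hef
    rcases lt_trichotomy i j with h | h | h
    · rw [(D.same_edge e i j h (Nat.lt_succ_iff.1 hj) hx).2,
        (D.same_edge e i j h (Nat.lt_succ_iff.1 hj) hy).2]
    · subst h; exact absurd rfl hst
    · rw [(D.same_edge e j i h (Nat.lt_succ_iff.1 hi) hx.symm).2,
        (D.same_edge e j i h (Nat.lt_succ_iff.1 hi) hy.symm).2]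
  · obtain ⟨w, hw, rfl⟩ := D.diff_edge e f hef i j (Nat.lt_succ_iff.1 hi) (Nat.lt_succ_iff.1 hj) hx
    obtain ⟨w', hw', rfl⟩ :=
      D.diff_edge e f hef i j (Nat.lt_succ_iff.1 hi) (Nat.lt_succ_iff.1 hj) hy
    by_contra hne
    have hww : w ≠ w' := fun h => hne (by rw [h])
    exact hef (Subtype.ext (((Sym2.mem_and_mem_iff hww).1 ⟨hw.1, hw'.1⟩).trans
      ((Sym2.mem_and_mem_iff hww).1 ⟨hw.2, hw'.2⟩).symm))

theorem disjoint_openSegment {s t : D.Seg} (hst : s ≠ t) :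
    Disjoint (openSegment ℝ (D.A s) (D.B s)) (segment ℝ (D.A t) (D.B t)) := by
  rw [Set.disjoint_left]
  intro x hx hx'
  obtain ⟨h1, h2, -⟩ := div_eq_neg_of_mem_openSegment (D.A_ne_B s) hx
  rcases D.endpoint_of_mem_inter hst (openSegment_subset_segment ℝ _ _ hx) hx' with rfl | rfl
  · exact h1 (sub_self _)
  · exact h2 (sub_self _)

/-- The midpoint of a segment. -/
noncomputable def X (s : D.Seg) : ℂ := (1 / 2 : ℝ) • D.A s + (1 / 2 : ℝ) • D.B s

theorem X_mem (s : D.Seg) : D.X s ∈ openSegment ℝ (D.A s) (D.B s) :=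
  ⟨1 / 2, 1 / 2, by norm_num, by norm_num, by norm_num, rfl⟩

/-- The tail of a dart. -/
def tail (d : G.edgeSet × Bool) : V := if d.2 then D.src d.1 else D.tgt d.1

/-- The reverse of a dart. -/
def flip (d : G.edgeSet × Bool) : G.edgeSet × Bool := (d.1, !d.2)

/-- The segment at the tail of a dart. -/
def firstSeg (d : G.edgeSet × Bool) : D.Seg := ⟨d.1, if d.2 then 0 else Fin.last _⟩

/-- The end different from the tail of the segment at the tail of a dart. -/
def far (d : G.edgeSet × Bool) : ℂ := if d.2 then D.B (D.firstSeg d) else D.A (D.firstSeg d)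

theorem segment_far (d : G.edgeSet × Bool) :
    segment ℝ (D.pos (D.tail d)) (D.far d) =
      segment ℝ (D.A (D.firstSeg d)) (D.B (D.firstSeg d)) := by
  obtain ⟨e, b⟩ := d
  cases b
  · rw [segment_symm]
    simp [far, tail, firstSeg, A, B, D.p_last]
  · simp [far, tail, firstSeg, A, B, D.p_zero]

theorem far_ne (d : G.edgeSet × Bool) : D.far d - D.pos (D.tail d) ≠ 0 := by
  have h := D.A_ne_B (D.firstSeg d)
  obtain ⟨e, b⟩ := d
  rw [sub_ne_zero]
  cases b
  · simpa [far, tail, firstSeg, A, B, D.p_last] using h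
  · simpa [far, tail, firstSeg, A, B, D.p_zero] using h.symm

theorem fst_ne_of_tail_eq {d d' : G.edgeSet × Bool} (h : D.tail d = D.tail d') (hne : d ≠ d') :
    d.1 ≠ d'.1 := by
  obtain ⟨e, b⟩ := d
  obtain ⟨e', b'⟩ := d'
  rintro (rfl : e = e')
  have := (D.adj e).ne
  cases b <;> cases b' <;> simp_all [tail]

theorem eq_firstSeg_of_mem {v : V} {s : D.Seg} (h : D.pos v ∈ segment ℝ (D.A s) (D.B s)) :
    ∃ d, D.tail d = v ∧ s = D.firstSeg d := by
  obtain ⟨e, i, hi⟩ := s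
  rcases D.mem_edge.1 (D.vertex_mem e i v (Nat.lt_succ_iff.1 hi) h) with rfl | rfl
  · have := D.eq_zero_of_src_mem (Nat.lt_succ_iff.1 hi) h
    subst this
    exact ⟨(e, true), rfl, rfl⟩
  · have := D.eq_m_of_tgt_mem (Nat.lt_succ_iff.1 hi) h
    subst this
    exact ⟨(e, false), rfl, rfl⟩

/-! ### Potentials of circulations on a drawing. -/

section Potential

variable [Fintype G.edgeSet]

/-- The potential of a weighting of the edges. -/
noncomputable def W (z : G.edgeSet → ℂ) : ℂ → ℂ := logPotential D.A D.B fun s => z s.1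

/-- Along an edge the sum telescopes to a difference between its two ends, that is, to a gradient,
and a circulation annihilates gradients. -/
theorem derivative_eq_zero [Fintype V] [DecidableEq V] {z : G.edgeSet → ℂ}
    (hz : boundaryMap D.src D.tgt z = 0) (q : ℂ) :
    ∑ s : D.Seg, z s.1 * (1 / (D.A s - q) - 1 / (D.B s - q)) = 0 := by
  rw [Fintype.sum_sigma]
  rw [← sum_mul_sub_eq_zero_of_boundary hz fun v => -(1 / (D.pos v - q))]
  refine Finset.sum_congr rfl fun e _ => ?_
  trans ∑ i : Fin (D.m e + 1), z e * (1 / (D.p e i - q) - 1 / (D.p e (i + 1) - q))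
  · rfl
  rw [← Finset.mul_sum]
  congr 1
  rw [Fin.sum_univ_eq_sum_range
    (fun i => 1 / (D.p e i - q) - 1 / (D.p e (i + 1) - q)) (D.m e + 1), Finset.sum_range_sub',
    D.p_zero, D.p_last]
  ring

/-- The union of all segments. -/
def carrier : Set ℂ := {x | ∃ s : D.Seg, x ∈ segment ℝ (D.A s) (D.B s)}

theorem eventually_mem_of_carrier (P : D.Seg → Prop) {q : ℂ}
    (h : ∀ s, q ∈ segment ℝ (D.A s) (D.B s) → P s) :
    ∀ᶠ y in 𝓝 q, y ∈ D.carrier → ∃ s, P s ∧ y ∈ segment ℝ (D.A s) (D.B s) := by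
  filter_upwards [eventually_notMem_segments D.A D.B (fun s => ¬ P s)
    (fun s hs hq => hs (h s hq))] with y hy
  rintro ⟨s, hs⟩
  exact ⟨s, by_contra fun hP => hy s hP hs, hs⟩

/-- The potential on the left side of each dart. -/
noncomputable def dartPotential : (G.edgeSet → ℂ) →ₗ[ℂ] (G.edgeSet × Bool → ℂ) where
  toFun z d := D.W z (D.X ⟨d.1, 0⟩) - if d.2 then 0 else 2 * Real.pi * Complex.I * z d.1
  map_add' z z' := by
    funext d
    have : D.W (z + z') (D.X ⟨d.1, 0⟩) = D.W z (D.X ⟨d.1, 0⟩) + D.W z' (D.X ⟨d.1, 0⟩) := by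
      simp [W, logPotential, add_mul, Finset.sum_add_distrib]
    simp only [Pi.add_apply, this]
    split_ifs <;> ring
  map_smul' r z := by
    funext d
    have : D.W (r • z) (D.X ⟨d.1, 0⟩) = r * D.W z (D.X ⟨d.1, 0⟩) := by
      simp [W, logPotential, mul_assoc, Finset.mul_sum]
    simp only [Pi.smul_apply, this, smul_eq_mul, RingHom.id_apply]
    split_ifs <;> ring

/-- The potentials of the two darts of an edge e differ by 2πi z(e). -/
theorem eq_zero_of_dartPotential_eq_zero {z : G.edgeSet → ℂ} (h : D.dartPotential z = 0) : z = 0 := by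
  funext e
  have h1 := congrFun h (e, true)
  have h2 := congrFun h (e, false)
  simp only [dartPotential, LinearMap.coe_mk, AddHom.coe_mk, if_true, Pi.zero_apply, sub_zero,
    Bool.false_eq_true, if_false] at h1 h2
  rw [h1, zero_sub, neg_eq_zero] at h2
  simpa [Real.pi_ne_zero] using h2

variable [Fintype V] [DecidableEq V] {z : G.edgeSet → ℂ}

theorem W_locally_constant (hz : boundaryMap D.src D.tgt z = 0) :
    ∀ x ∉ D.carrier, ∀ᶠ y in 𝓝 x, D.W z y = D.W z x := fun _ hx =>
  logPotential_eventually_eq (D.derivative_eq_zero hz) fun s h => hx ⟨s, h⟩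

theorem leftVal_W (hz : boundaryMap D.src D.tgt z = 0) (s : D.Seg) :
    LeftVal (D.W z) (D.A s) (D.B s) (D.W z (D.X s)) ∧
    LeftVal (D.W z) (D.B s) (D.A s) (D.W z (D.X s) - 2 * Real.pi * Complex.I * z s.1) := by
  classical
  exact leftVal_logPotential (D.derivative_eq_zero hz) s (D.A_ne_B s)
    (fun t ht => D.disjoint_openSegment ht.symm) (D.X_mem s)

/-- At a bend only the two consecutive segments meet, so the germ following the outgoing one is the
incoming one, and their left sides carry the same value. The value at a midpoint is the left value.
-/
theorem W_X_succ (hz : boundaryMap D.src D.tgt z = 0) (e : G.edgeSet) (i : ℕ)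
    (hi : i + 1 < D.m e + 1) :
    D.W z (D.X ⟨e, i, by omega⟩) = D.W z (D.X ⟨e, i + 1, hi⟩) := by
  let s : D.Seg := ⟨e, i, by omega⟩
  let t : D.Seg := ⟨e, i + 1, hi⟩
  have hst : s ≠ t := by simp [s, t]
  have hq : D.B s = D.A t := rfl
  let u : Bool → ℂ := fun b => if b then D.B t - D.A t else D.A s - D.A t
  have hut : segment ℝ (D.A t) (D.A t + u true) = segment ℝ (D.A t) (D.B t) := by simp [u]
  have huf : segment ℝ (D.A t) (D.A t + u false) = segment ℝ (D.A s) (D.B s) := by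
    rw [segment_symm ℝ (D.A s), hq]; simp [u]
  have hms : D.A t ∈ segment ℝ (D.A s) (D.B s) := hq ▸ right_mem_segment ℝ _ _
  have hmt : D.A t ∈ segment ℝ (D.A t) (D.B t) := left_mem_segment ℝ _ _
  obtain ⟨b, hb, hf⟩ := exists_next_germ (D.A t) u (by
      rintro (_ | _)
      · simpa [u, sub_ne_zero, ← hq] using D.A_ne_B s
      · simpa [u, sub_ne_zero] using (D.A_ne_B t).symm)
    (by
      rintro (_ | _) (_ | _) h
      · exact absurd rfl h
      · rw [hut, huf]
        exact fun x hx => D.eq_of_mem_inter hst hx ⟨hms, hmt⟩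
      · rw [hut, huf]
        exact fun x hx => D.eq_of_mem_inter hst hx.symm ⟨hms, hmt⟩
      · exact absurd rfl h) D.carrier
    (by
      filter_upwards [D.eventually_mem_of_carrier (q := D.A t) (fun r => r = s ∨ r = t) (by
        rintro ⟨f, j, hj⟩ hr
        by_contra! hcon
        obtain ⟨hcon1, hcon2⟩ := hcon
        by_cases hef : f = e
        · subst hef
          have h1 : j ≠ i := fun h => hcon1 (by subst h; rfl)
          have h2 : j ≠ i + 1 := fun h => hcon2 (by subst h; rfl)
          rcases Nat.lt_or_gt_of_ne h1 with h | h
          · exact D.A_ne_B s ((D.same_edge f j i h (by omega) ⟨hr, hms⟩).2.symm)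
          · obtain ⟨h3, h4⟩ := D.same_edge f (i + 1) j (by omega) (by omega) ⟨hmt, hr⟩
            rw [h3] at h4
            exact D.A_ne_B t h4
        · obtain ⟨w, hw, hwx⟩ := D.diff_edge f e hef j i (by omega) (by omega) ⟨hr, hms⟩
          rcases D.mem_edge.1 hw.2 with rfl | rfl
          · have hmt' : D.pos (D.src e) ∈ segment ℝ (D.p e (i + 1)) (D.p e (i + 1 + 1)) := by
              rw [hwx]; exact hmt
            exact absurd (D.eq_zero_of_src_mem (by omega) hmt') (by omega)
          · have hms' : D.pos (D.tgt e) ∈ segment ℝ (D.p e i) (D.p e (i + 1)) := by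
              rw [hwx]; exact hms
            exact absurd (D.eq_m_of_tgt_mem (by omega) hms') (by omega))] with y hy hyK
      obtain ⟨r, hr | hr, hyr⟩ := hy hyK
      · exact ⟨false, by rw [huf, ← hr]; exact hyr⟩
      · exact ⟨true, by rw [hut, ← hr]; exact hyr⟩) true
  have hb' : b = false := by simpa using hb ⟨false, by simp⟩
  subst hb'
  refine (hf (D.W z) (D.W_locally_constant hz) _ _ ?_ ?_).symm
  · simpa [u] using (D.leftVal_W hz t).1
  · have := (D.leftVal_W hz s).1
    rw [hq] at this
    simpa [u] using this

theorem W_X_eq (hz : boundaryMap D.src D.tgt z = 0) (e : G.edgeSet) (i : Fin (D.m e + 1)) :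
    D.W z (D.X ⟨e, i⟩) = D.W z (D.X ⟨e, 0⟩) := by
  obtain ⟨i, hi⟩ := i
  induction i with
  | zero => rfl
  | succ i ih => rw [← W_X_succ D hz, ih]

theorem leftVal_dartPotential (hz : boundaryMap D.src D.tgt z = 0) (d : G.edgeSet × Bool) :
    LeftVal (D.W z) (D.pos (D.tail d)) (D.far d) (D.dartPotential z d) ∧
    LeftVal (D.W z) (D.far d) (D.pos (D.tail d)) (D.dartPotential z (flip d)) := by
  have h := D.leftVal_W hz (D.firstSeg d)
  obtain ⟨e, b⟩ := d
  rw [firstSeg, W_X_eq D hz] at h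
  cases b
  · simpa [dartPotential, far, tail, firstSeg, A, B, D.p_last, flip] using h.symm
  · simpa [dartPotential, far, tail, firstSeg, A, B, D.p_zero, flip] using h

/-- `d'` follows `d` counterclockwise around their common tail; the sector between them lies to the
left of `d` and to the left of the reverse of `d'`. -/
theorem exists_next_dart (d : G.edgeSet × Bool) :
    ∃ d', D.tail d' = D.tail d ∧ ((∃ d'', d'' ≠ d ∧ D.tail d'' = D.tail d) → d' ≠ d) ∧
      ∀ z, boundaryMap D.src D.tgt z = 0 → D.dartPotential z d = D.dartPotential z (flip d') := by
  let v := D.tail d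
  have hseg : ∀ j : {d // D.tail d = v}, segment ℝ (D.pos v) (D.pos v + (D.far j.1 - D.pos v)) =
      segment ℝ (D.A (D.firstSeg j.1)) (D.B (D.firstSeg j.1)) := by
    rintro ⟨j, hj⟩
    rw [add_sub_cancel]
    have := D.segment_far j
    rwa [hj] at this
  obtain ⟨⟨d', hd'⟩, h1, h2⟩ := exists_next_germ (J := {d // D.tail d = v}) (D.pos v)
    (fun j => D.far j.1 - D.pos v)
    (by
      rintro ⟨j, hj⟩
      change D.far j - D.pos v ≠ 0
      rw [← hj]
      exact D.far_ne j)
    (by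
      intro i j hij x hx
      rw [hseg, hseg] at hx
      refine D.eq_of_mem_inter ?_ hx ?_
      · intro h
        exact D.fst_ne_of_tail_eq (i.2.trans j.2.symm) (fun h => hij (Subtype.ext h))
          (congrArg Sigma.fst h)
      · rw [← hseg, ← hseg]
        exact ⟨left_mem_segment ℝ _ _, left_mem_segment ℝ _ _⟩) D.carrier
    (by
      filter_upwards [D.eventually_mem_of_carrier (q := D.pos v)
        (fun s => ∃ d, D.tail d = v ∧ s = D.firstSeg d)
        (fun s hs => D.eq_firstSeg_of_mem hs)] with y hy hyK
      obtain ⟨s, ⟨d, hd, rfl⟩, hys⟩ := hy hyK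
      exact ⟨⟨d, hd⟩, by rw [hseg]; exact hys⟩) ⟨d, rfl⟩
  refine ⟨d', hd', ?_, ?_⟩
  · rintro ⟨d'', hne, ht⟩ rfl
    exact h1 ⟨⟨d'', ht⟩, fun h => hne (congrArg Subtype.val h)⟩ rfl
  · intro z hz
    refine h2 (D.W z) (D.W_locally_constant hz) _ _ ?_ ?_
    · simpa [v] using (D.leftVal_dartPotential hz d).1
    · have := (D.leftVal_dartPotential hz d').2
      rw [hd'] at this
      simpa using this

end Potential

end SimpleGraph.Drawing

/-- Euler's inequality for planar graphs of minimum degree at least two without closed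
nonbacktracking walks of length less than `g`. -/
theorem SimpleGraph.IsPlanar.card_edgeSet_le {V : Type*} [Fintype V] {G : SimpleGraph V}
    [Fintype G.edgeSet] (hG : G.IsPlanar) (hdeg : ∀ v w, G.Adj v w → ∃ w', w' ≠ w ∧ G.Adj v w')
    (g : ℕ) (hg : ∀ k, 0 < k → k < g → ∀ x : ℕ → V, (∀ i, G.Adj (x i) (x (i + 1))) →
      (∀ i, x (i + 2) ≠ x i) → (∀ i, x (i + k) = x i) → False) :
    g * Fintype.card G.edgeSet ≤ 2 * Fintype.card G.edgeSet + g * Fintype.card V := by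
  classical
  obtain ⟨D⟩ := hG.nonempty_drawing
  have hadj : ∀ d, G.Adj (D.tail d) (D.tail (Drawing.flip d)) := by
    rintro ⟨e, _ | _⟩
    · exact (D.adj e).symm
    · exact D.adj e
  have hdart : ∀ v w, G.Adj v w → ∃ d, D.tail d = v ∧ D.tail (Drawing.flip d) = w := by
    intro v w h
    have := D.edge_eq ⟨s(v, w), h⟩
    rcases Sym2.eq_iff.1 this with ⟨h1, h2⟩ | ⟨h1, h2⟩
    · exact ⟨(⟨s(v, w), h⟩, true), h1.symm, h2.symm⟩
    · exact ⟨(⟨s(v, w), h⟩, false), h1.symm, h2.symm⟩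
  choose σ hσ1 hσ2 hσ3 using D.exists_next_dart
  have hflip : ∀ d : G.edgeSet × Bool, Drawing.flip (Drawing.flip d) = d := by
    rintro ⟨e, b⟩; simp [Drawing.flip]
  have hinj : ∀ d d', D.tail d = D.tail d' → D.tail (Drawing.flip d) = D.tail (Drawing.flip d') →
      d = d' := by
    intro d d' h1 h2
    by_contra hne
    refine D.fst_ne_of_tail_eq h1 hne ?_
    obtain ⟨e, b⟩ := d
    obtain ⟨e', b'⟩ := d'
    refine Subtype.ext ?_
    rw [D.edge_eq e, D.edge_eq e']
    cases b <;> cases b' <;> simp_all [Drawing.tail, Drawing.flip, Sym2.eq_swap]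
  have hσ : ∀ d, σ d ≠ d := by
    intro d
    refine hσ2 d ?_
    obtain ⟨w', hw', h⟩ := hdeg _ _ (hadj d)
    obtain ⟨d'', h1, h2⟩ := hdart _ _ h
    exact ⟨d'', fun h => hw' (by rw [← h2, h]), h1⟩
  -- The map sending d to the reverse of `σ d` walks backwards along the face to the left of d,
  -- since its value ends where d starts. As `σ d ≠ d`, the walk never backtracks, and a period
  -- below `g` would be a forbidden closed walk.
  refine card_edges_le_of_dart_potential D.src D.tgt g D.dartPotential
    (fun z => D.eq_zero_of_dartPotential_eq_zero) (fun d => Drawing.flip (σ d))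
    (fun z hz d => (hσ3 d z hz).symm) ?_
  intro k hk0 hkg d hd
  set τ : G.edgeSet × Bool → G.edgeSet × Bool := fun d => Drawing.flip (σ d) with hτ
  have hhead : ∀ d, D.tail (Drawing.flip (τ d)) = D.tail d := by
    intro d; rw [hτ]; simp only; rw [hflip, hσ1]
  refine hg k hk0 hkg (fun i => D.tail (Drawing.flip (τ^[i] d))) ?_ ?_ ?_
  · intro i
    simp only [Function.iterate_succ_apply', hhead]
    exact (hadj _).symm
  · intro i h
    simp only [Function.iterate_succ_apply', hhead] at h
    exact hσ _ (hinj _ _ (hσ1 _) h)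
  · intro i
    simp only [Function.iterate_add_apply, hd]

/-! ### Sparsity of planar graphs of large girth -/

theorem SimpleGraph.IsPlanar.induce {V : Type*} {G : SimpleGraph V} (h : G.IsPlanar) (S : Set V) :
    (G.induce S).IsPlanar := by
  obtain ⟨pos, arc, hpos, harc, hv, hd⟩ := h
  have hmem : ∀ e : Sym2 S, e ∈ (G.induce S).edgeSet → e.map Subtype.val ∈ G.edgeSet := by
    intro e
    induction e using Sym2.ind with
    | _ u v => exact fun h => h
  refine ⟨fun v => pos v, fun e => arc (e.map Subtype.val), hpos.comp Subtype.val_injective,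
    fun u v h => harc u v h, fun e he w hw => ?_, fun e he f hf hef => ?_⟩
  · obtain ⟨w', hw', h⟩ := Sym2.mem_map.1 (hv _ (hmem e he) w hw)
    rwa [Subtype.ext h] at hw'
  · refine (hd _ (hmem e he) _ (hmem f hf)
      (fun h => hef (Sym2.map.injective Subtype.val_injective h))).trans ?_
    rintro _ ⟨w, ⟨hw1, hw2⟩, rfl⟩
    obtain ⟨w', hw', rfl⟩ := Sym2.mem_map.1 hw1
    obtain ⟨w'', hw'', h⟩ := Sym2.mem_map.1 hw2
    rw [Subtype.ext h] at hw''
    exact ⟨w', ⟨hw', hw''⟩, rfl⟩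

section Sparse

open Classical in
/-- The degree of `v` into the set `S`. -/
noncomputable def degIn {V : Type*} (G : SimpleGraph V) (S : Finset V) (v : V) : ℕ :=
  (S.filter (G.Adj v)).card

variable {V : Type*} {G : SimpleGraph V}

theorem sum_degIn_comm (S T : Finset V) :
    ∑ v ∈ S, degIn G T v = ∑ v ∈ T, degIn G S v := by
  classical
  simp only [degIn, Finset.card_filter]
  rw [Finset.sum_comm]
  simp only [G.adj_comm]

theorem degIn_mono {S T : Finset V} (h : S ⊆ T) (v : V) : degIn G S v ≤ degIn G T v := by
  classical
  exact Finset.card_le_card (Finset.filter_subset_filter _ h)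

theorem degIn_union [DecidableEq V] {S T : Finset V} (h : Disjoint S T) (v : V) :
    degIn G (S ∪ T) v = degIn G S v + degIn G T v := by
  classical
  rw [degIn, Finset.filter_union, Finset.card_union_of_disjoint]
  · rfl
  · exact Finset.disjoint_filter_filter h

theorem sum_degIn_union [DecidableEq V] {S T : Finset V} (h : Disjoint S T) :
    ∑ v ∈ S ∪ T, degIn G (S ∪ T) v =
      ∑ v ∈ S, degIn G S v + 2 * ∑ v ∈ T, degIn G S v + ∑ v ∈ T, degIn G T v := by
  simp only [degIn_union h]
  rw [Finset.sum_union h, Finset.sum_add_distrib, Finset.sum_add_distrib, sum_degIn_comm S T]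
  ring

theorem sum_degIn_eq [Fintype V] (S : Finset V) :
    ∑ v ∈ S, degIn G S v = 2 * Nat.card (G.induce (S : Set V)).edgeSet := by
  classical
  rw [Nat.card_eq_fintype_card]
  have h := (G.induce (S : Set V)).sum_degrees_eq_twice_card_edges
  rw [SimpleGraph.edgeFinset_card] at h
  convert h using 1
  rw [← Finset.sum_coe_sort]
  refine Finset.sum_congr rfl fun v _ => ?_
  rw [degIn, ← SimpleGraph.card_neighborFinset_eq_degree,
    ← Finset.card_map (Function.Embedding.subtype (· ∈ (S : Set V)))]
  congr 1
  ext w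
  simp only [Finset.mem_filter, Finset.mem_map, SimpleGraph.mem_neighborFinset]
  constructor
  · rintro ⟨h1, h2⟩
    exact ⟨⟨w, h1⟩, h2, rfl⟩
  · rintro ⟨⟨w', h1⟩, h2, rfl⟩
    exact ⟨h1, h2⟩

/-- Deleting a vertex of degree at most one lowers the degree sum by at most 2 and preserves the
inequality by induction. Once no such vertex is left, Euler's inequality applies to the induced
graph. -/
theorem SimpleGraph.IsPlanar.sum_degIn_le [Fintype V] (hG : G.IsPlanar) (g : ℕ) (S : Finset V)
    (hg : ∀ k, 0 < k → k < g → ∀ x : ℕ → V, (∀ i, x i ∈ S) → (∀ i, G.Adj (x i) (x (i + 1))) →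
      (∀ i, x (i + 2) ≠ x i) → (∀ i, x (i + k) = x i) → False) :
    g * ∑ v ∈ S, degIn G S v ≤ 2 * ∑ v ∈ S, degIn G S v + 2 * g * S.card := by
  classical
  induction S using Finset.strongInduction with
  | H S ih =>
    by_cases hlow : ∃ v ∈ S, degIn G S v ≤ 1
    · obtain ⟨v, hv, hd⟩ := hlow
      have ih := ih (S.erase v) (Finset.erase_ssubset hv) fun k h1 h2 x hx =>
        hg k h1 h2 x fun i => Finset.mem_of_mem_erase (hx i)
      have hdis : Disjoint (S.erase v) {v} := by simp
      have hun : S.erase v ∪ {v} = S := by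
        ext w; by_cases h : w = v <;> simp [h, hv]
      have hsum := sum_degIn_union (G := G) hdis
      rw [hun, Finset.sum_singleton, Finset.sum_singleton] at hsum
      have h0 : degIn G {v} v = 0 := by simp [degIn, Finset.filter_singleton]
      have h1 : degIn G (S.erase v) v ≤ 1 := (degIn_mono (Finset.erase_subset _ _) v).trans hd
      have hc := Finset.card_erase_add_one hv
      rw [h0] at hsum
      nlinarith [Nat.mul_le_mul_left g h1]
    · push Not at hlow
      have := (hG.induce (S : Set V)).card_edgeSet_le ?_ g ?_
      · rw [sum_degIn_eq, Nat.card_eq_fintype_card]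
        simp only [Finset.coe_sort_coe, Fintype.card_coe] at this ⊢
        nlinarith
      · intro v w hvw
        have h2 := hlow v v.2
        obtain ⟨w', hw', hne⟩ := Finset.exists_mem_ne h2 w.1
        rw [Finset.mem_filter] at hw'
        exact ⟨⟨w', hw'.1⟩, fun h => hne (congrArg Subtype.val h), hw'.2⟩
      · intro k h1 h2 x hx1 hx2 hx3
        exact hg k h1 h2 (fun i => x i) (fun i => (x i).2) hx1
          (fun i h => hx2 i (Subtype.ext h)) (fun i => by rw [hx3 i])

/-- Four vertices that form a cycle of length four, in this order. -/
structure SimpleGraph.IsFourCycle (G : SimpleGraph V) (v a b c : V) : Prop where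
  va : G.Adj v a
  ab : G.Adj a b
  bc : G.Adj b c
  cv : G.Adj c v
  bv : b ≠ v
  ca : c ≠ a

theorem SimpleGraph.CliqueFree.not_adj_three (h : G.CliqueFree 3) {a b c : V} (hab : G.Adj a b)
    (hbc : G.Adj b c) : ¬ G.Adj c a := by
  classical
  intro hca
  exact h {a, b, c} (SimpleGraph.is3Clique_triple_iff.2 ⟨hab, hca.symm, hbc⟩)

/-- Closed nonbacktracking walks of length 1, 2, 3 and 4 are, respectively, a loop, a backtrack, a
triangle and a four-cycle. Only the last needs an extra hypothesis, and only for g = 5. -/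
theorem no_short_closed_walk (h3 : G.CliqueFree 3) {S : Finset V} {g : ℕ} (hg : g ≤ 5)
    (h4 : g = 5 → ∀ v ∈ S, ∀ a ∈ S, ∀ b ∈ S, ∀ c ∈ S, ¬ G.IsFourCycle v a b c) :
    ∀ k, 0 < k → k < g → ∀ x : ℕ → V, (∀ i, x i ∈ S) → (∀ i, G.Adj (x i) (x (i + 1))) →
      (∀ i, x (i + 2) ≠ x i) → (∀ i, x (i + k) = x i) → False := by
  intro k hk0 hkg x hx h1 h2 hk
  have : k ≤ 4 := by omega
  interval_cases k
  · exact (h1 0).ne (hk 0).symm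
  · exact h2 0 (hk 0)
  · refine h3.not_adj_three (h1 0) (h1 1) ?_
    have := h1 2
    rwa [hk 0] at this
  · have h := h1 3
    rw [hk 0] at h
    exact h4 (by omega) _ (hx 0) _ (hx 1) _ (hx 2) _ (hx 3)
      ⟨h1 0, h1 1, h1 2, h, h2 0, h2 1⟩

/-- Here `R` stands for the vertices removed in the first step and `D` for those removed in the
second. The light vertices `W` outside `R` span no four-cycle and are too sparse to account for the
degree sum of `A`, unless many edges touch `R` or the heavy vertices `H`; both are bounded by |R| +
|D|. -/
theorem card_le_mul_card_removed [Fintype V] (hG : G.IsPlanar) (h3 : G.CliqueFree 3)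
    (A R D : Finset V) (hRA : R ⊆ A) (hDA : D ⊆ A) (hR : ∀ v ∈ R, degIn G A v ≤ 4)
    (hD : ∀ v ∈ A, v ∉ R → v ∉ D → 4 ≤ degIn G A v)
    (hC : ∀ v a b c, G.IsFourCycle v a b c → (∀ w ∈ [v, a, b, c], w ∈ A ∧ degIn G A w ≤ 4) →
      v ∈ R) :
    A.card ≤ 78 * (R.card + D.card) := by
  classical
  have e1 := hG.sum_degIn_le 4 A (no_short_closed_walk h3 (by norm_num) (by norm_num))
  set H := A.filter (fun v => 5 ≤ degIn G A v) with hH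
  set W := A.filter (fun v => degIn G A v ≤ 4 ∧ v ∉ R) with hW
  have e2 := hG.sum_degIn_le 5 W (no_short_closed_walk h3 le_rfl (by
    intro _ v hv a ha b hb c hc h
    simp only [hW, Finset.mem_filter] at hv ha hb hc
    refine hv.2.2 (hC v a b c h ?_)
    simp only [List.mem_cons, List.not_mem_nil, or_false]
    rintro w (rfl | rfl | rfl | rfl)
    exacts [⟨hv.1, hv.2.1⟩, ⟨ha.1, ha.2.1⟩, ⟨hb.1, hb.2.1⟩, ⟨hc.1, hc.2.1⟩]))
  -- Vertices outside `R` and `D` have degree at least 4. With the bound 4|A| on the degree sum from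
  -- `e1`, the excess over 4 on `H` is therefore at most 4(|R| + |D|).
  have e3 : 4 * A.card + ∑ v ∈ H, (degIn G A v - 4) ≤
      ∑ v ∈ A, degIn G A v + 4 * R.card + 4 * D.card := by
    have hRs : 4 * R.card = ∑ v ∈ A, if v ∈ R then 4 else 0 := by
      rw [← Finset.sum_filter, Finset.filter_mem_eq_inter, Finset.inter_eq_right.2 hRA,
        Finset.sum_const, smul_eq_mul, mul_comm]
    have hDs : 4 * D.card = ∑ v ∈ A, if v ∈ D then 4 else 0 := by
      rw [← Finset.sum_filter, Finset.filter_mem_eq_inter, Finset.inter_eq_right.2 hDA,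
        Finset.sum_const, smul_eq_mul, mul_comm]
    rw [hRs, hDs, hH, Finset.sum_filter, mul_comm, ← smul_eq_mul, ← Finset.sum_const,
      ← Finset.sum_add_distrib, ← Finset.sum_add_distrib, ← Finset.sum_add_distrib]
    refine Finset.sum_le_sum fun v hv => ?_
    have := hD v hv
    split_ifs <;> first | omega | (have := this (by assumption) (by assumption); omega)
  -- For d ≥ 5 one has d ≤ 5(d - 4).
  have e4 : ∑ v ∈ H, degIn G A v ≤ 5 * ∑ v ∈ H, (degIn G A v - 4) := by
    rw [Finset.mul_sum]
    refine Finset.sum_le_sum fun v hv => ?_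
    have := (Finset.mem_filter.1 hv).2
    omega
  have hWA : W ⊆ A := Finset.filter_subset _ _
  have hdis : Disjoint W (A \ W) := Finset.disjoint_sdiff
  have e5 := sum_degIn_union (G := G) hdis
  rw [Finset.union_sdiff_of_subset hWA] at e5
  have e6 : ∑ v ∈ A \ W, degIn G W v + ∑ v ∈ A \ W, degIn G (A \ W) v
      = ∑ v ∈ A \ W, degIn G A v := by
    rw [← Finset.sum_add_distrib]
    refine Finset.sum_congr rfl fun v _ => ?_
    rw [← degIn_union hdis, Finset.union_sdiff_of_subset hWA]
  have e7 : ∑ v ∈ A \ W, degIn G A v ≤ ∑ v ∈ R, degIn G A v + ∑ v ∈ H, degIn G A v := by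
    refine le_trans (Finset.sum_le_sum_of_subset (t := R ∪ H) ?_)
      (le_of_add_le_left (Finset.sum_union_inter ..).le)
    intro v hv
    simp only [hW, hH, Finset.mem_sdiff, Finset.mem_filter, Finset.mem_union] at hv ⊢
    by_contra! hcon
    have := hcon.2 hv.1
    exact hv.2 ⟨hv.1, by omega, hcon.1⟩
  -- The bookkeeping behind 78: the degree sum of `A` is at least 4|A| - 4(|R| + |D|) and at most
  -- (10/3)|W| + 2(4|R| + 20(|R| + |D|)). With |W| ≤ |A| this gives (2/3)|A| ≤ 52|R| + 44|D|.
  have e8 : ∑ v ∈ R, degIn G A v ≤ R.card * 4 := Finset.sum_le_card_nsmul _ _ _ hR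
  have e9 := Finset.card_le_card hWA
  omega

end Sparse

/-! ### The peeling process in explicit terms -/

namespace SimpleGraph

variable {V : Type*} {G : SimpleGraph V}

theorem IsFourCycle.rotate {v a b c : V} (h : G.IsFourCycle v a b c) : G.IsFourCycle a b c v :=
  ⟨h.ab, h.bc, h.cv, h.va, h.ca, h.bv.symm⟩

/-- The vertex `v` lies on a four-cycle of `G` within `A` whose vertices have at most four
neighbours in `A`. -/
def OnFour (G : SimpleGraph V) (A : Set V) (v : V) : Prop :=
  ∃ a b c, G.IsFourCycle v a b c ∧ ∀ w ∈ [v, a, b, c], w ∈ A ∧ (G.neighborSet w ∩ A).ncard ≤ 4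

/-- The vertices of `A` that are not on a light four-cycle. -/
def stepOne (G : SimpleGraph V) (A : Set V) : Set V := {v | v ∈ A ∧ ¬ G.OnFour A v}

/-- The vertices of `U` with at least four neighbours in `U`. -/
def stepTwo (G : SimpleGraph V) (U : Set V) : Set V :=
  {v | v ∈ U ∧ 4 ≤ (G.neighborSet v ∩ U).ncard}

/-- The sets of active vertices after each step of the peeling process. -/
def chain (G : SimpleGraph V) : ℕ → Set V
  | 0 => Set.univ
  | k + 1 => if Even k then stepOne G (chain G k) else stepTwo G (chain G k)

theorem ncard_neighborSet_induce (A : Set V) (w : A) :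
    ((G.induce A).neighborSet w).ncard = (G.neighborSet w ∩ A).ncard := by
  rw [← Set.ncard_image_of_injective _ Subtype.val_injective]
  congr 1
  ext x
  simp only [Set.mem_image, mem_neighborSet, Set.mem_inter_iff]
  constructor
  · rintro ⟨y, hy, rfl⟩
    exact ⟨hy, y.2⟩
  · rintro ⟨h1, h2⟩
    exact ⟨⟨x, h2⟩, h1, rfl⟩

theorem afterStepTwo_eq (U : Set V) : afterStepTwo G U = stepTwo G U := by
  ext v
  simp only [afterStepTwo, stepTwo, Set.mem_sdiff, Set.mem_image, Set.mem_ofPred_eq,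
    ncard_neighborSet_induce]
  constructor
  · rintro ⟨h1, h2⟩
    exact ⟨h1, not_lt.1 fun h => h2 ⟨⟨v, h1⟩, h, rfl⟩⟩
  · rintro ⟨h1, h2⟩
    refine ⟨h1, ?_⟩
    rintro ⟨x, hx, rfl⟩
    omega

/-- Without triangles a four-cycle has no chord, so its vertices do not induce a complete graph;
having four vertices, they do not induce an odd cycle. Hence every four-cycle is removable. -/
theorem mem_onRemovableFourCycle_iff (h3 : G.CliqueFree 3) {v : V} :
    v ∈ G.onRemovableFourCycle ↔ ∃ a b c, G.IsFourCycle v a b c ∧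
      ∀ w ∈ [v, a, b, c], (G.neighborSet w).ncard ≤ 4 := by
  classical
  constructor
  · rintro ⟨u, C, ⟨hC, -, -⟩, hlen, hdeg, hv⟩
    have hv' : v ∈ C.support := hv
    have hC' := hC.rotate hv'
    have hlen' : (C.rotate v hv').length = 4 := by rw [Walk.length_rotate, hlen]
    have hdeg' : ∀ w ∈ (C.rotate v hv').support, (G.neighborSet w).ncard ≤ 4 := fun w hw =>
      hdeg w ((C.mem_support_rotate_iff v hv').1 hw)
    generalize C.rotate v hv' = D at hC' hlen' hdeg'
    match D, hC', hlen', hdeg' with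
    | .cons (v := a) h1 (.cons (v := b) h2 (.cons (v := c) h3 (.cons h4 .nil))), hC', _, hdeg' =>
      have hn := hC'.support_nodup
      simp only [Walk.support_cons, Walk.support_nil, List.tail_cons, List.nodup_cons,
        List.mem_cons, List.not_mem_nil, or_false, not_or] at hn
      refine ⟨a, b, c, ⟨h1, h2, h3, h4, hn.2.1.2, Ne.symm hn.1.2.1⟩, fun w hw => hdeg' w ?_⟩
      simp only [Walk.support_cons, Walk.support_nil, List.mem_cons, List.not_mem_nil,
        or_false] at hw ⊢
      tauto
  · rintro ⟨a, b, c, h, hdeg⟩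
    let C : G.Walk v v := .cons h.va (.cons h.ab (.cons h.bc (.cons h.cv .nil)))
    have hset : cycleVerts C = {v, a, b, c} := by
      ext w
      simp only [cycleVerts, C, Walk.support_cons, Walk.support_nil, List.mem_cons,
        List.not_mem_nil, or_false, Set.mem_ofPred_eq, Set.mem_insert_iff, Set.mem_singleton_iff]
      tauto
    have hva := h.va.ne
    have hab := h.ab.ne
    have hbc := h.bc.ne
    have hcv := h.cv.ne
    have hbv := h.bv
    have hca := h.ca
    refine ⟨v, C, ⟨?_, ?_, ?_⟩, rfl, ?_, ?_⟩
    · rw [Walk.isCycle_def, Walk.isTrail_def]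
      refine ⟨?_, by simp [C], ?_⟩
      · simp only [C, Walk.edges_cons, Walk.edges_nil, List.nodup_cons, List.mem_cons,
          List.not_mem_nil, or_false, Sym2.eq_iff, not_or, not_and, List.nodup_nil, not_false_eq_true,
          and_true]
        grind
      · simp only [C, Walk.support_cons, Walk.support_nil, List.tail_cons, List.nodup_cons,
          List.mem_cons, List.not_mem_nil, or_false, not_or, List.nodup_nil, not_false_eq_true,
          and_true]
        exact ⟨⟨hab, hca.symm, hva.symm⟩, ⟨hbc, hbv⟩, hcv⟩
    · intro htop
      have hb : b ∈ cycleVerts C := by rw [hset]; simp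
      have hv : v ∈ cycleVerts C := by rw [hset]; simp
      have : (G.induce (cycleVerts C)).Adj ⟨b, hb⟩ ⟨v, hv⟩ := by
        rw [htop, top_adj]
        exact fun h => hbv (congrArg Subtype.val h)
      exact h3.not_adj_three h.va h.ab this
    · rintro ⟨k, hk, ⟨e⟩⟩
      have h1 : Nat.card (cycleVerts C) = k := by
        rw [Nat.card_congr e.toEquiv, Nat.card_eq_fintype_card, Fintype.card_fin]
      have h2 : (cycleVerts C).ncard = 4 := by
        rw [hset, Set.ncard_insert_of_notMem, Set.ncard_insert_of_notMem, Set.ncard_pair hbc] <;>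
          simp [hva, hab, hcv.symm, hbv.symm, hca.symm]
      rw [Nat.card_coe_set_eq, h2] at h1
      subst h1
      exact absurd hk (by decide)
    · rw [hset]
      intro w hw
      apply hdeg
      simpa using hw
    · rw [hset]; simp

theorem afterStepOne_eq (h3 : G.CliqueFree 3) (A : Set V) : afterStepOne G A = stepOne G A := by
  have h3' : (G.induce A).CliqueFree 3 := h3.comap ⟨(Embedding.induce A).toCopy⟩
  have key : ∀ v : A, v ∈ (G.induce A).onRemovableFourCycle ↔ G.OnFour A v := by
    intro v
    rw [mem_onRemovableFourCycle_iff h3']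
    constructor
    · rintro ⟨a, b, c, h, hd⟩
      refine ⟨a, b, c, ⟨h.va, h.ab, h.bc, h.cv, fun h' => h.bv (Subtype.ext h'),
        fun h' => h.ca (Subtype.ext h')⟩, ?_⟩
      simp only [List.mem_cons, List.not_mem_nil, or_false, forall_eq_or_imp, forall_eq,
        ncard_neighborSet_induce] at hd ⊢
      exact ⟨⟨v.2, hd.1⟩, ⟨a.2, hd.2.1⟩, ⟨b.2, hd.2.2.1⟩, ⟨c.2, hd.2.2.2⟩⟩
    · rintro ⟨a, b, c, h, hd⟩
      simp only [List.mem_cons, List.not_mem_nil, or_false, forall_eq_or_imp, forall_eq] at hd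
      refine ⟨⟨a, hd.2.1.1⟩, ⟨b, hd.2.2.1.1⟩, ⟨c, hd.2.2.2.1⟩, ⟨h.va, h.ab, h.bc, h.cv,
        fun h' => h.bv (congrArg Subtype.val h'), fun h' => h.ca (congrArg Subtype.val h')⟩, ?_⟩
      simp only [List.mem_cons, List.not_mem_nil, or_false, forall_eq_or_imp, forall_eq,
        ncard_neighborSet_induce]
      exact ⟨hd.1.2, hd.2.1.2, hd.2.2.1.2, hd.2.2.2.2⟩
  ext v
  simp only [afterStepOne, stepOne, Set.mem_sdiff, Set.mem_image, Set.mem_ofPred_eq]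
  constructor
  · rintro ⟨h1, h2⟩
    exact ⟨h1, fun h => h2 ⟨⟨v, h1⟩, (key _).2 h, rfl⟩⟩
  · rintro ⟨h1, h2⟩
    refine ⟨h1, ?_⟩
    rintro ⟨x, hx, rfl⟩
    exact h2 ((key x).1 hx)

theorem chain_two_mul (h3 : G.CliqueFree 3) (i : ℕ) : G.chain (2 * i) = G.activeSet i := by
  induction i with
  | zero => rfl
  | succ i ih =>
    rw [show 2 * (i + 1) = 2 * i + 1 + 1 by ring, chain, chain, if_neg (by simp), if_pos (by simp),
      ih, activeSet, afterStepTwo_eq, afterStepOne_eq h3]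

theorem chain_two_mul_add_one (h3 : G.CliqueFree 3) (i : ℕ) :
    G.chain (2 * i + 1) = afterStepOne G (G.activeSet i) := by
  rw [chain, if_pos (by simp), chain_two_mul h3, afterStepOne_eq h3]

/-! ### Geometric decay of the active sets. -/

theorem degIn_eq_ncard (A : Finset V) (v : V) :
    degIn G A v = (G.neighborSet v ∩ A).ncard := by
  classical
  rw [degIn, ← Set.ncard_coe_finset]
  congr 1
  ext w
  simp [and_comm]

/-- At least a 1/78 fraction is removed, and 77/78 < 0.99. -/
theorem IsPlanar.ncard_activeSet_succ_le [Finite V] (hG : G.IsPlanar) (h3 : G.CliqueFree 3)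
    (i : ℕ) : ((G.activeSet (i + 1)).ncard : ℝ) ≤ 0.99 * (G.activeSet i).ncard := by
  classical
  have := Fintype.ofFinite V
  rw [activeSet, afterStepTwo_eq, afterStepOne_eq h3]
  obtain ⟨A, hA⟩ : ∃ A : Finset V, (A : Set V) = G.activeSet i :=
    ⟨(G.activeSet i).toFinset, by simp⟩
  rw [← hA]
  set R := A.filter (fun v => G.OnFour A v) with hR
  set D := A.filter (fun v => v ∈ stepOne G A ∧ v ∉ stepTwo G (stepOne G A)) with hD
  have hcard := card_le_mul_card_removed hG h3 A R D (Finset.filter_subset _ _)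
    (Finset.filter_subset _ _)
    (fun v hv => by
      obtain ⟨-, a, b, c, -, h⟩ := Finset.mem_filter.1 hv
      rw [degIn_eq_ncard]
      exact (h v (by simp)).2)
    (fun v hv h1 h2 => by
      simp only [hR, hD, Finset.mem_filter, hv, true_and, not_and, not_not] at h1 h2
      rw [degIn_eq_ncard]
      refine (h2 ⟨hv, h1⟩).2.trans (Set.ncard_le_ncard ?_)
      exact Set.inter_subset_inter_right _ fun x hx => hx.1)
    (fun v a b c h hd => by
      refine Finset.mem_filter.2 ⟨(hd v (by simp)).1, a, b, c, h, fun w hw => ⟨(hd w hw).1, ?_⟩⟩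
      rw [← degIn_eq_ncard]
      exact (hd w hw).2)
  have hdis : Disjoint R D := by
    rw [Finset.disjoint_left]
    intro v h1 h2
    exact (Finset.mem_filter.1 h2).2.1.2 (Finset.mem_filter.1 h1).2
  have hle : (stepTwo G (stepOne G A)).ncard + (R ∪ D).card ≤ A.card := by
    rw [← Set.ncard_coe_finset (R ∪ D), ← Set.ncard_union_eq, ← Set.ncard_coe_finset A]
    · refine Set.ncard_le_ncard ?_
      intro v hv
      rcases hv with hv | hv
      · exact hv.1.1
      · rcases Finset.mem_union.1 (Finset.mem_coe.1 hv) with hv | hv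
        · exact (Finset.mem_filter.1 hv).1
        · exact (Finset.mem_filter.1 hv).1
    · rw [Set.disjoint_left]
      intro v hv hv'
      rcases Finset.mem_union.1 (Finset.mem_coe.1 hv') with h | h
      · exact hv.1.2 (Finset.mem_filter.1 h).2
      · exact (Finset.mem_filter.1 h).2.2 hv
  rw [Finset.card_union_of_disjoint hdis] at hle
  rw [Set.ncard_coe_finset]
  have h1 : (A.card : ℝ) ≤ 78 * (R.card + D.card) := by exact_mod_cast hcard
  have h2 : ((stepTwo G (stepOne G A)).ncard : ℝ) + (R.card + D.card) ≤ A.card := by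
    exact_mod_cast hle
  linarith

theorem IsPlanar.activeSet_numIterations_eq_empty [Fintype V] (hG : G.IsPlanar)
    (h3 : G.CliqueFree 3) : G.activeSet (numIterations (Fintype.card V)) = ∅ := by
  have hpow : ∀ i, ((G.activeSet i).ncard : ℝ) ≤ 0.99 ^ i * Fintype.card V := by
    intro i
    induction i with
    | zero => simp [activeSet, Set.ncard_univ]
    | succ i ih =>
      refine (hG.ncard_activeSet_succ_le h3 i).trans ?_
      rw [pow_succ']
      nlinarith
  rw [← Set.ncard_eq_zero (Set.toFinite _)]
  by_contra hne
  have h1 : (1 : ℝ) ≤ (G.activeSet (numIterations (Fintype.card V))).ncard := by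
    exact_mod_cast Nat.one_le_iff_ne_zero.2 hne
  have h2 := hpow (numIterations (Fintype.card V))
  set n := Fintype.card V
  have hn : (0 : ℝ) < n := by
    rcases Nat.eq_zero_or_pos n with h | h
    · rw [h] at h2 hne; norm_num at h2; exact absurd h2 hne
    · exact_mod_cast h
  set L := ⌈Real.logb 2 n⌉₊ with hL
  have h3 : (n : ℝ) ≤ 2 ^ L := by
    have := Nat.le_ceil (Real.logb 2 n)
    rw [Real.logb_le_iff_le_rpow (by norm_num) hn, Real.rpow_natCast] at this
    exact this
  -- Since 0.99^70 < 1/2, each block of 70 iterations halves the set. The one additional iteration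
  -- leaves the factor 0.99, which makes the final cardinality strictly less than 1.
  have h4 : (0.99 : ℝ) ^ numIterations n ≤ 0.99 * (1 / 2) ^ L := by
    rw [numIterations, pow_add, pow_one, pow_mul]
    gcongr
    norm_num
  have h5 : (0.99 : ℝ) ^ numIterations n * n ≤ 0.99 * (1 / 2) ^ L * 2 ^ L := by
    gcongr
  rw [mul_assoc, ← mul_pow] at h5
  norm_num at h5
  linarith

end SimpleGraph

/-! ### Local functions of a graph and the full-information algorithm -/

/-- The graphs `H` and `H'` have the same neighbourhoods within distance `t` of `x`. -/
def LocalEq (H H' : SimpleGraph ℕ) : ℕ → ℕ → Prop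
  | 0, x => H.neighborSet x = H'.neighborSet x
  | t + 1, x => H.neighborSet x = H'.neighborSet x ∧ ∀ u ∈ H.neighborSet x, LocalEq H H' t u

/-- A function of a graph and a vertex that depends only on the neighbourhoods within distance `t`
of the vertex. -/
def IsLocal {α : Type*} (t : ℕ) (f : SimpleGraph ℕ → ℕ → α) : Prop :=
  ∀ H H' x, LocalEq H H' t x → f H x = f H' x

namespace LocalEq

variable {H H' : SimpleGraph ℕ} {t s x u : ℕ}

theorem neighborSet_eq (h : LocalEq H H' t x) : H.neighborSet x = H'.neighborSet x := by
  cases t with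
  | zero => exact h
  | succ t => exact h.1

theorem adj_iff (h : LocalEq H H' t x) : H.Adj x u ↔ H'.Adj x u :=
  Set.ext_iff.1 h.neighborSet_eq u

theorem of_adj (h : LocalEq H H' (t + 1) x) (hu : H.Adj x u) : LocalEq H H' t u := h.2 u hu

theorem mono (h : LocalEq H H' s x) (hts : t ≤ s) : LocalEq H H' t x := by
  induction t generalizing s x with
  | zero => exact h.neighborSet_eq
  | succ t ih =>
    obtain ⟨s, rfl⟩ : ∃ s', s = s' + 1 := ⟨s - 1, by omega⟩
    exact ⟨h.1, fun u hu => ih (h.2 u hu) (by omega)⟩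

theorem symm (h : LocalEq H H' t x) : LocalEq H' H t x := by
  induction t generalizing x with
  | zero => exact Eq.symm h
  | succ t ih => exact ⟨h.1.symm, fun u hu => ih (h.2 u (h.1 ▸ hu))⟩

end LocalEq

theorem IsLocal.mono {α : Type*} {t s : ℕ} {f : SimpleGraph ℕ → ℕ → α} (h : IsLocal t f)
    (hts : t ≤ s) : IsLocal s f := fun H H' x hx => h H H' x (hx.mono hts)

/-! ### Simulation of local functions by message passing. -/

section Simulation

variable {V : Type*}

/-- The edges that a vertex knows after `t` rounds. -/
def knownEdges (G : SimpleGraph V) (ident : V → ℕ) : ℕ → V → Set (ℕ × ℕ)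
  | 0, _ => ∅
  | t + 1, v => knownEdges G ident t v ∪
      {e | ∃ u, G.Adj v u ∧ (e = (ident v, ident u) ∨ e ∈ knownEdges G ident t u)}

/-- The algorithm in which every vertex forwards all it knows and finally evaluates `F`. -/
def fullInformation {Out : Type} (F : ℕ → SimpleGraph ℕ → ℕ → Out) : LocalAlgorithm Out where
  State := ℕ × ℕ × Set (ℕ × ℕ)
  Msg := ℕ × ℕ × Set (ℕ × ℕ)
  init n i := (n, i, ∅)
  send s _ := some s
  step s l := (s.1, s.2.1, s.2.2 ∪ {e | ∃ m, some m ∈ l ∧ (e = (s.2.1, m.2.1) ∨ e ∈ m.2.2)})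
  output s := F s.1 (SimpleGraph.fromRel fun a b => (a, b) ∈ s.2.2) s.2.1

theorem stateAfter_fullInformation [Fintype V] {Out : Type} (F : ℕ → SimpleGraph ℕ → ℕ → Out)
    (G : SimpleGraph V) [DecidableRel G.Adj] (ident : V → ℕ) (ports : PortNumbering G) (t : ℕ)
    (v : V) : (fullInformation F).stateAfter G ident ports t v =
      (Fintype.card V, ident v, knownEdges G ident t v) := by
  induction t generalizing v with
  | zero => rfl
  | succ t ih =>
    rw [LocalAlgorithm.stateAfter]
    simp only [ih]
    simp only [fullInformation, knownEdges, Prod.mk.injEq, true_and]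
    congr 1
    ext e
    simp only [List.mem_ofFn, Option.some.injEq, Set.mem_ofPred_eq]
    constructor
    · rintro ⟨m, ⟨i, rfl⟩, h⟩
      exact ⟨_, (ports v i).2, h⟩
    · rintro ⟨u, hu, h⟩
      refine ⟨_, ⟨(ports v).symm ⟨u, hu⟩, rfl⟩, ?_⟩
      simpa using h

variable {G : SimpleGraph V} {ident : V → ℕ}

theorem knownEdges_subset (t : ℕ) (v : V) :
    knownEdges G ident t v ⊆ {e | ∃ a b, G.Adj a b ∧ e = (ident a, ident b)} := by
  induction t generalizing v with
  | zero => exact Set.empty_subset _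
  | succ t ih =>
    rintro e (he | ⟨u, hu, rfl | he⟩)
    · exact ih v he
    · exact ⟨v, u, hu, rfl⟩
    · exact ih u he

/-- Stated for any set `K` of true edges containing what `v` knows, so that the induction can pass
to a neighbour: what the neighbour knew one round earlier is part of what `v` knows. -/
theorem localEq_of_knownEdges_subset (hi : Function.Injective ident) (K : Set (ℕ × ℕ))
    (hK : K ⊆ {e | ∃ a b, G.Adj a b ∧ e = (ident a, ident b)}) (t : ℕ) (v : V)
    (hv : knownEdges G ident (t + 1) v ⊆ K) :
    LocalEq (G.map ident) (SimpleGraph.fromRel fun a b => (a, b) ∈ K) t (ident v) := by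
  have hadj : ∀ a b, (SimpleGraph.fromRel fun a b => (a, b) ∈ K).Adj a b →
      (G.map ident).Adj a b := by
    intro a b h
    rw [SimpleGraph.fromRel_adj] at h
    refine (SimpleGraph.map_adj' ..).2 ⟨h.1, ?_⟩
    rcases h.2 with h | h <;> obtain ⟨a', b', h1, h2⟩ := hK h <;> cases h2
    · exact ⟨a', b', h1, rfl, rfl⟩
    · exact ⟨b', a', h1.symm, rfl, rfl⟩
  have hnb : ∀ t v, knownEdges G ident (t + 1) v ⊆ K → (G.map ident).neighborSet (ident v) =
      (SimpleGraph.fromRel fun a b => (a, b) ∈ K).neighborSet (ident v) := by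
    intro t v hv
    ext x
    refine ⟨fun h => ?_, fun h => hadj _ _ h⟩
    obtain ⟨hne, a, b, hab, h1, rfl⟩ := (SimpleGraph.map_adj' ..).1 h
    rw [hi h1] at hab
    have hm : (ident v, ident b) ∈ K := hv (Or.inr ⟨b, hab, Or.inl rfl⟩)
    rw [SimpleGraph.mem_neighborSet, SimpleGraph.fromRel_adj]
    exact ⟨hne, Or.inl hm⟩
  induction t generalizing v with
  | zero => exact hnb 0 v hv
  | succ t ih =>
    refine ⟨hnb _ v hv, fun x hx => ?_⟩
    obtain ⟨hne, a, b, hab, h1, rfl⟩ := (SimpleGraph.map_adj' ..).1 hx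
    rw [hi h1] at hab
    exact ih b fun e he => hv (Or.inr ⟨b, hab, Or.inr he⟩)

/-- The extra round is needed because agreement at radius 0 already includes the edges at the vertex
itself. -/
theorem outputAfter_fullInformation [Fintype V] {Out : Type} {F : ℕ → SimpleGraph ℕ → ℕ → Out}
    [DecidableRel G.Adj] (hi : Function.Injective ident) (ports : PortNumbering G) {t : ℕ}
    (hF : IsLocal t (F (Fintype.card V))) (v : V) :
    (fullInformation F).outputAfter G ident ports (t + 1) v =
      F (Fintype.card V) (G.map ident) (ident v) := by
  rw [LocalAlgorithm.outputAfter, stateAfter_fullInformation]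
  exact (hF _ _ _ (localEq_of_knownEdges_subset hi _ (knownEdges_subset _ _) t v subset_rfl)).symm

end Simulation

/-! ### Locality of the peeling process -/

theorem neighborSet_inter_eq {A : SimpleGraph ℕ → Set ℕ} {t : ℕ} (hA : IsLocal t fun H x => x ∈ A H)
    {H H' : SimpleGraph ℕ} {x : ℕ} (h : LocalEq H H' (t + 1) x) :
    H.neighborSet x ∩ A H = H'.neighborSet x ∩ A H' := by
  ext u
  rw [Set.mem_inter_iff, Set.mem_inter_iff, ← h.neighborSet_eq]
  refine and_congr_right fun hu => ?_
  exact iff_of_eq (hA H H' u (h.of_adj hu))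

/-- The opposite vertex of a four-cycle is at distance two, and its active degree needs one step
more. -/
theorem isLocal_stepOne {A : SimpleGraph ℕ → Set ℕ} {t : ℕ} (hA : IsLocal t fun H x => x ∈ A H) :
    IsLocal (t + 3) fun H x => x ∈ H.stepOne (A H) := by
  have key : ∀ H H' x, LocalEq H H' (t + 3) x → H.OnFour (A H) x → H'.OnFour (A H') x := by
    rintro H H' x hx ⟨a, b, c, h, hd⟩
    have ha := hx.of_adj h.va
    have hb := ha.of_adj h.ab
    have hc := hx.of_adj h.cv.symm
    refine ⟨a, b, c, ⟨hx.adj_iff.1 h.va, ha.adj_iff.1 h.ab, hb.adj_iff.1 h.bc, hc.adj_iff.1 h.cv,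
      h.bv, h.ca⟩, fun w hw => ?_⟩
    have hw' : LocalEq H H' (t + 1) w := by
      simp only [List.mem_cons, List.not_mem_nil, or_false] at hw
      rcases hw with rfl | rfl | rfl | rfl
      exacts [hx.mono (by omega), ha.mono (by omega), hb, hc.mono (by omega)]
    rw [← neighborSet_inter_eq hA hw']
    exact ⟨(iff_of_eq (hA H H' w (hw'.mono (by omega)))).1 (hd w hw).1, (hd w hw).2⟩
  intro H H' x hx
  simp only [SimpleGraph.stepOne, Set.mem_ofPred_eq]
  rw [propext ⟨key H H' x hx, key H' H x hx.symm⟩]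
  exact congrArg (· ∧ _) (hA H H' x (hx.mono (by omega)))

theorem isLocal_stepTwo {A : SimpleGraph ℕ → Set ℕ} {t : ℕ} (hA : IsLocal t fun H x => x ∈ A H) :
    IsLocal (t + 1) fun H x => x ∈ H.stepTwo (A H) := by
  intro H H' x hx
  simp only [SimpleGraph.stepTwo, Set.mem_ofPred_eq]
  rw [neighborSet_inter_eq hA hx]
  exact congrArg (· ∧ _) (hA H H' x (hx.mono (by omega)))

theorem isLocal_chain (k : ℕ) : IsLocal (3 * k) fun H x => x ∈ H.chain k := by
  induction k with
  | zero => intro H H' x _; simp [SimpleGraph.chain]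
  | succ k ih =>
    simp only [SimpleGraph.chain]
    split_ifs
    · exact isLocal_stepOne ih
    · exact (isLocal_stepTwo ih).mono (by omega)

open Classical in
/-- The last of the first `K` steps before which a vertex is active. -/
noncomputable def peelRank (H : SimpleGraph ℕ) : ℕ → ℕ → ℕ
  | 0, _ => 0
  | k + 1, x => if x ∈ H.chain (k + 1) then k + 1 else peelRank H k x

theorem isLocal_peelRank (k : ℕ) : IsLocal (3 * k) fun H x => peelRank H k x := by
  induction k with
  | zero => intro H H' x _; rfl
  | succ k ih =>
    intro H H' x hx
    have h1 : (x ∈ H.chain (k + 1)) = (x ∈ H'.chain (k + 1)) := isLocal_chain (k + 1) H H' x hx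
    have h2 : peelRank H k x = peelRank H' k x := ih H H' x (hx.mono (by omega))
    simp only [peelRank, h2]
    by_cases h : x ∈ H.chain (k + 1)
    · rw [if_pos h, if_pos (h1.mp h)]
    · rw [if_neg h, if_neg fun h' => h (h1.mpr h')]

theorem SimpleGraph.chain_succ_subset {V : Type*} (H : SimpleGraph V) (k : ℕ) :
    H.chain (k + 1) ⊆ H.chain k := by
  rw [SimpleGraph.chain]
  split_ifs
  · exact fun x hx => hx.1
  · exact fun x hx => hx.1

theorem SimpleGraph.chain_antitone {V : Type*} (H : SimpleGraph V) : Antitone H.chain :=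
  antitone_nat_of_succ_le H.chain_succ_subset

/-- The chain is decreasing and empty from `K` on, so one number records membership in all its sets,
and layers become level sets of `peelRank`. -/
theorem mem_chain_iff_le_peelRank {H : SimpleGraph ℕ} {K : ℕ} (hK : H.chain K = ∅) (m x : ℕ) :
    x ∈ H.chain m ↔ m ≤ peelRank H K x := by
  have key : ∀ k, x ∈ H.chain (peelRank H k x) ∧ ∀ m ≤ k, x ∈ H.chain m → m ≤ peelRank H k x := by
    intro k
    induction k with
    | zero => exact ⟨Set.mem_univ x, fun m hm _ => hm⟩
    | succ k ih =>
      rw [peelRank]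
      split_ifs with h
      · exact ⟨h, fun m hm _ => hm⟩
      · refine ⟨ih.1, fun m hm hx => ih.2 m ?_ hx⟩
        rcases hm.lt_or_eq with h' | rfl
        · omega
        · exact absurd hx h
  constructor
  · intro hm
    refine (key K).2 m (le_of_not_gt fun h => ?_) hm
    have := H.chain_antitone h.le hm
    rw [hK] at this
    exact this
  · exact fun h => H.chain_antitone h (key K).1

/-! ### Conflicts -/

/-- The vertices that are reached from `x` by at most `r` steps inside the layer of `x`. -/
def layerBall (H : SimpleGraph ℕ) (l : ℕ → ℕ) : ℕ → ℕ → Set ℕ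
  | 0, x => {x}
  | r + 1, x => layerBall H l r x ∪ {y | ∃ u, H.Adj x u ∧ l u = l x ∧ y ∈ layerBall H l r u}

section LayerBall

variable {H : SimpleGraph ℕ} {l : ℕ → ℕ} {r s x y z : ℕ}

theorem self_mem_layerBall : x ∈ layerBall H l r x := by
  induction r with
  | zero => rfl
  | succ r ih => exact Or.inl ih

theorem layerBall_mono (h : r ≤ s) : layerBall H l r x ⊆ layerBall H l s x := by
  induction s, h using Nat.le_induction with
  | base => exact subset_rfl
  | succ s _ ih => exact ih.trans Set.subset_union_left

theorem layer_eq_of_mem_layerBall (h : y ∈ layerBall H l r x) : l y = l x := by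
  induction r generalizing x with
  | zero => rw [h]
  | succ r ih =>
    rcases h with h | ⟨u, -, h1, h2⟩
    · exact ih h
    · rw [ih h2, h1]

theorem mem_layerBall_trans (hy : y ∈ layerBall H l r x) (hz : z ∈ layerBall H l s y) :
    z ∈ layerBall H l (r + s) x := by
  induction r generalizing x with
  | zero => cases hy; rwa [zero_add]
  | succ r ih =>
    rcases hy with h | ⟨u, h0, h1, h2⟩
    · exact layerBall_mono (by omega) (ih h)
    · rw [Nat.add_right_comm]
      exact Or.inr ⟨u, h0, h1, ih h2⟩

theorem mem_layerBall_one (h : H.Adj x y) (hl : l y = l x) : y ∈ layerBall H l 1 x :=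
  Or.inr ⟨y, h, hl, rfl⟩

theorem mem_layerBall_symm (h : y ∈ layerBall H l r x) : x ∈ layerBall H l r y := by
  induction r generalizing x with
  | zero => cases h; rfl
  | succ r ih =>
    rcases h with h | ⟨u, h0, h1, h2⟩
    · exact layerBall_mono (by omega) (ih h)
    · exact mem_layerBall_trans (ih h2) (mem_layerBall_one h0.symm h1.symm)

theorem layerBall_finite (hfin : ∀ x, (H.neighborSet x).Finite) (r x : ℕ) :
    (layerBall H l r x).Finite := by
  induction r generalizing x with
  | zero => exact Set.finite_singleton x
  | succ r ih =>
    refine (ih x).union (((hfin x).biUnion fun u _ => ih u).subset ?_)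
    rintro y ⟨u, h0, -, h2⟩
    exact Set.mem_biUnion h0 h2

/-- A ball of radius r + 1 is covered by the balls of radius r at its centre and at no more than
four neighbours in the layer. -/
theorem ncard_layerBall_le (hfin : ∀ x, (H.neighborSet x).Finite)
    (hdeg : ∀ x, {u | H.Adj x u ∧ l u = l x}.ncard ≤ 4) (r x : ℕ) :
    (layerBall H l r x).ncard ≤ 5 ^ r := by
  classical
  induction r generalizing x with
  | zero => simp [layerBall]
  | succ r ih =>
    have hN : {u | H.Adj x u ∧ l u = l x}.Finite := (hfin x).subset fun u hu => hu.1
    have h1 : {y | ∃ u, H.Adj x u ∧ l u = l x ∧ y ∈ layerBall H l r u} =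
        ⋃ u ∈ hN.toFinset, layerBall H l r u := by
      ext y; simp [and_assoc]
    have h2 : (⋃ u ∈ hN.toFinset, layerBall H l r u).ncard ≤ 4 * 5 ^ r := by
      refine (Finset.set_ncard_biUnion_le _ _).trans ?_
      refine (Finset.sum_le_card_nsmul _ _ (5 ^ r) fun u _ => ih u).trans ?_
      rw [smul_eq_mul, ← Set.ncard_eq_toFinset_card _ hN]
      exact Nat.mul_le_mul_right _ (hdeg x)
    rw [layerBall, h1]
    refine (Set.ncard_union_le _ _).trans ?_
    have := ih x
    rw [pow_succ]
    omega

end LayerBall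

/-- `Q` assigns to each vertex a set of vertices within distance `r`, depending only on the
neighbourhoods within distance `t + r`. -/
def IsLocalNbhd (t r : ℕ) (Q : SimpleGraph ℕ → ℕ → Set ℕ) : Prop :=
  ∀ s ≥ t, ∀ H H' x, LocalEq H H' (s + r) x → Q H x = Q H' x ∧ ∀ y ∈ Q H x, LocalEq H H' s y

theorem isLocalNbhd_layerBall {l : SimpleGraph ℕ → ℕ → ℕ} {t : ℕ} (hl : IsLocal t l) (r : ℕ) :
    IsLocalNbhd t r fun H x => layerBall H (l H) r x := by
  have key : ∀ r, ∀ s ≥ t, ∀ H H' x, LocalEq H H' (s + r) x →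
      ∀ y ∈ layerBall H (l H) r x, y ∈ layerBall H' (l H') r x ∧ LocalEq H H' s y := by
    intro r
    induction r with
    | zero =>
      rintro s - H H' x hx y rfl
      exact ⟨rfl, hx⟩
    | succ r ih =>
      rintro s hs H H' x hx y (hy | ⟨u, h0, h1, h2⟩)
      · obtain ⟨h1, h2⟩ := ih s hs H H' x (hx.mono (by omega)) y hy
        exact ⟨Or.inl h1, h2⟩
      · have hu : LocalEq H H' (s + r) u := LocalEq.of_adj (t := s + r) hx h0
        obtain ⟨h3, h4⟩ := ih s hs H H' u hu y h2
        refine ⟨Or.inr ⟨u, hx.adj_iff.1 h0, ?_, h3⟩, h4⟩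
        rw [← hl H H' u (hu.mono (by omega)), ← hl H H' x (hx.mono (by omega)), h1]
  intro s hs H H' x hx
  refine ⟨Set.Subset.antisymm (fun y hy => (key r s hs H H' x hx y hy).1)
    (fun y hy => (key r s hs H' H x hx.symm y hy).1), fun y hy => (key r s hs H H' x hx y hy).2⟩

/-! ### Colouring bounded-degree conflict graphs bit by bit -/

open Classical in
/-- Greedy colouring of a conflict graph in the order of the colours `c`. -/
noncomputable def greedyColor (Q : ℕ → Set ℕ) (c : ℕ → ℕ) : ℕ → ℕ → ℕ
  | 0, _ => 0
  | k + 1, x => if c x = k then sInf {m | ∀ y ∈ Q x, m ≠ greedyColor Q c k y}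
      else greedyColor Q c k x

/-- A colouring with `M` colours of a conflict graph; after `j` rounds it is proper on pairs whose
identifiers differ only in the last `j` bits. -/
noncomputable def bitColor (M : ℕ) (Q : ℕ → Set ℕ) : ℕ → ℕ → ℕ
  | 0, _ => 0
  | j + 1, x => greedyColor (fun x => {y | y ∈ Q x ∧ y / 2 ^ (j + 1) = x / 2 ^ (j + 1)})
      (fun x => bitColor M Q j x + M * (x / 2 ^ j % 2)) (2 * M) x

section Greedy

variable {Q : ℕ → Set ℕ} {c : ℕ → ℕ} {M : ℕ}

theorem sInf_avoid_lt (hfin : ∀ x, (Q x).Finite) (hcard : ∀ x, (Q x).ncard < M) (f : ℕ → ℕ)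
    (x : ℕ) : sInf {m | ∀ y ∈ Q x, m ≠ f y} < M ∧ ∀ y ∈ Q x, sInf {m | ∀ y ∈ Q x, m ≠ f y} ≠ f y := by
  classical
  obtain ⟨m, hm, hmx⟩ : ∃ m < M, ∀ y ∈ Q x, m ≠ f y := by
    by_contra! hcon
    have h1 : Finset.range M ⊆ (hfin x).toFinset.image f := by
      intro m hm
      obtain ⟨y, hy, rfl⟩ := hcon m (Finset.mem_range.1 hm)
      exact Finset.mem_image_of_mem _ (by simpa using hy)
    have h2 := (Finset.card_le_card h1).trans Finset.card_image_le
    rw [Finset.card_range, ← Set.ncard_eq_toFinset_card _ (hfin x)] at h2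
    exact absurd (hcard x) (by omega)
  exact ⟨(Nat.sInf_le (s := {m | ∀ y ∈ Q x, m ≠ f y}) hmx).trans_lt hm, Nat.sInf_mem (s := {m | ∀ y ∈ Q x, m ≠ f y}) ⟨m, hmx⟩⟩

theorem greedyColor_lt (hfin : ∀ x, (Q x).Finite) (hcard : ∀ x, (Q x).ncard < M) (hM : 0 < M)
    (k x : ℕ) : greedyColor Q c k x < M := by
  induction k with
  | zero => exact hM
  | succ k ih =>
    rw [greedyColor]
    split_ifs
    · exact (sInf_avoid_lt hfin hcard _ x).1
    · exact ih

/-- As `c` is proper, two conflicting vertices never choose in the same stage, and the later one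
avoids the colour already settled for the earlier one. Avoiding the default 0 of vertices not yet
treated costs nothing, since there are more colours than conflicts. -/
theorem greedyColor_ne (hfin : ∀ x, (Q x).Finite) (hcard : ∀ x, (Q x).ncard < M)
    (hsymm : ∀ x y, y ∈ Q x → x ∈ Q y) (hc : ∀ x y, y ∈ Q x → c x ≠ c y) (k : ℕ) {x y : ℕ}
    (hxy : y ∈ Q x) (hx : c x < k) (hy : c y < k) : greedyColor Q c k x ≠ greedyColor Q c k y := by
  induction k with
  | zero => omega
  | succ k ih =>
    have hne := hc x y hxy
    rw [greedyColor, greedyColor]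
    split_ifs with h1 h2 h2
    · omega
    · exact (sInf_avoid_lt hfin hcard _ x).2 y hxy
    · exact ((sInf_avoid_lt hfin hcard _ y).2 x (hsymm x y hxy)).symm
    · exact ih (by omega) (by omega)

theorem bitColor_lt (hfin : ∀ x, (Q x).Finite) (hcard : ∀ x, (Q x).ncard < M) (hM : 0 < M)
    (j x : ℕ) : bitColor M Q j x < M := by
  cases j with
  | zero => exact hM
  | succ j =>
    exact greedyColor_lt (fun x => (hfin x).subset fun y hy => hy.1)
      (fun x => (Set.ncard_le_ncard (fun y hy => hy.1) (hfin x)).trans_lt (hcard x)) hM _ _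

/-- For pairs that agree above bit j, the previous colour together with bit j is a proper colouring
with 2M colours: if bit j agrees, induction applies, otherwise the bits differ. The greedy pass
reduces it to M colours again. -/
theorem bitColor_ne (hfin : ∀ x, (Q x).Finite) (hcard : ∀ x, (Q x).ncard < M) (hM : 0 < M)
    (hsymm : ∀ x y, y ∈ Q x → x ∈ Q y) (hirr : ∀ x, x ∉ Q x) (j : ℕ) {x y : ℕ} (hxy : y ∈ Q x)
    (h : y / 2 ^ j = x / 2 ^ j) : bitColor M Q j x ≠ bitColor M Q j y := by
  induction j generalizing x y with
  | zero =>
    simp only [pow_zero, Nat.div_one] at h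
    exact absurd (h ▸ hxy) (hirr x)
  | succ j ih =>
    have hlt := bitColor_lt hfin hcard hM j
    have hpos : ∀ x, bitColor M Q j x + M * (x / 2 ^ j % 2) < 2 * M := by
      intro x
      have := hlt x
      rcases Nat.mod_two_eq_zero_or_one (x / 2 ^ j) with h | h <;> rw [h] <;> omega
    refine greedyColor_ne (Q := fun x => {y | y ∈ Q x ∧ y / 2 ^ (j + 1) = x / 2 ^ (j + 1)})
      (fun x => (hfin x).subset fun y hy => hy.1)
      (fun x => (Set.ncard_le_ncard (fun y hy => hy.1) (hfin x)).trans_lt (hcard x))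
      (fun x y hy => ⟨hsymm x y hy.1, hy.2.symm⟩) ?_ _ ⟨hxy, h⟩ (hpos x) (hpos y)
    rintro x y ⟨hy, hd⟩ heq
    have h1 := hlt x
    have h2 := hlt y
    have h3 : x / 2 ^ j % 2 = y / 2 ^ j % 2 := by
      rcases Nat.mod_two_eq_zero_or_one (x / 2 ^ j) with h | h <;>
        rcases Nat.mod_two_eq_zero_or_one (y / 2 ^ j) with h' | h' <;>
        simp only [h, h'] at heq ⊢ <;> omega
    rw [pow_succ, ← Nat.div_div_eq_div_mul, ← Nat.div_div_eq_div_mul] at hd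
    exact ih hy (by omega) (by rw [h3] at heq; omega)

end Greedy

/-- Each greedy stage reads only the conflict neighbourhood, which lies within distance r. -/
theorem isLocal_greedyColor {t r s : ℕ} (hs : t ≤ s) {Q : SimpleGraph ℕ → ℕ → Set ℕ}
    (hQ : IsLocalNbhd t r Q) {c : SimpleGraph ℕ → ℕ → ℕ} (hc : IsLocal s c) (k : ℕ) :
    IsLocal (s + k * r) fun H x => greedyColor (Q H) (c H) k x := by
  induction k with
  | zero => intro H H' x _; rfl
  | succ k ih =>
    intro H H' x hx
    have hx' : LocalEq H H' (s + k * r + r) x := by rwa [add_assoc, ← Nat.succ_mul]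
    obtain ⟨h1, h2⟩ := hQ _ (hs.trans (Nat.le_add_right s (k * r))) H H' x hx'
    have h3 : {m | ∀ y ∈ Q H x, m ≠ greedyColor (Q H) (c H) k y} =
        {m | ∀ y ∈ Q H' x, m ≠ greedyColor (Q H') (c H') k y} := by
      ext m
      rw [Set.mem_ofPred_eq, Set.mem_ofPred_eq, ← h1]
      refine forall₂_congr fun y hy => ?_
      have h4 : greedyColor (Q H) (c H) k y = greedyColor (Q H') (c H') k y := ih H H' y (h2 y hy)
      rw [h4]
    simp only [greedyColor]
    have h4 : greedyColor (Q H) (c H) k x = greedyColor (Q H') (c H') k x :=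
      ih H H' x (hx'.mono (Nat.le_add_right _ _))
    rw [hc H H' x (hx.mono (Nat.le_add_right _ _)), h4, h3]

theorem isLocal_bitColor {t r : ℕ} {Q : SimpleGraph ℕ → ℕ → Set ℕ} (hQ : IsLocalNbhd t r Q)
    (M j : ℕ) : IsLocal (t + j * (2 * M * r)) fun H x => bitColor M (Q H) j x := by
  induction j with
  | zero => intro H H' x _; rfl
  | succ j ih =>
    have h1 : IsLocalNbhd t r fun H x =>
        {y | y ∈ Q H x ∧ y / 2 ^ (j + 1) = x / 2 ^ (j + 1)} := by
      intro s hs H H' x hx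
      obtain ⟨h1, h2⟩ := hQ s hs H H' x hx
      exact ⟨by simp only [h1], fun y hy => h2 y hy.1⟩
    have h2 : IsLocal (t + j * (2 * M * r)) fun H x => bitColor M (Q H) j x + M * (x / 2 ^ j % 2) :=
      fun H H' x hx => congrArg (· + M * (x / 2 ^ j % 2)) (ih H H' x hx)
    rw [Nat.succ_mul, ← add_assoc]
    exact isLocal_greedyColor (Nat.le_add_right t _) h1 h2 (2 * M)

/-! ### Colouring by recolouring gadgets -/

/-- `κ` colours the set `S` in such a way that all edges from `S` to the layers not before the layer
of `x` are properly coloured if `κ` is used on `S` and `c` is used elsewhere. -/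
def IsRecoloring (H : SimpleGraph ℕ) (l : ℕ → ℕ) (S : Set ℕ) (x : ℕ) (c κ : ℕ → Fin 4) : Prop :=
  ∀ y ∈ S, ∀ w, H.Adj y w → l x ≤ l w → (w ∈ S → κ y ≠ κ w) ∧ (w ∉ S → κ y ≠ c w)

/-- The sets around `x` in its layer that can be recoloured whatever the other colours are. -/
def gadgets (H : SimpleGraph ℕ) (l : ℕ → ℕ) (x : ℕ) : Set (Set ℕ) :=
  {S | x ∈ S ∧ S ⊆ layerBall H l 2 x ∧ ∀ c, ∃ κ, IsRecoloring H l S x c κ}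

open Classical in
/-- A member of a family of sets, if there is one. -/
noncomputable def pickOrEmpty (F : Set (Set ℕ)) : Set ℕ := if h : F.Nonempty then h.some else ∅

/-- A chosen gadget of `x`. -/
noncomputable def gadget (H : SimpleGraph ℕ) (l : ℕ → ℕ) (x : ℕ) : Set ℕ :=
  pickOrEmpty (gadgets H l x)

/-- A chosen recolouring of the gadget of `x`. -/
noncomputable def recolor (H : SimpleGraph ℕ) (l : ℕ → ℕ) (x : ℕ) (c : ℕ → Fin 4) : ℕ → Fin 4 :=
  Classical.epsilon (IsRecoloring H l (gadget H l x) x c)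

/-- The vertices of stage `k` whose gadget contains `y`. -/
def touching (H : SimpleGraph ℕ) (l σ : ℕ → ℕ) (k y : ℕ) : Set ℕ :=
  {x | y ∈ gadget H l x ∧ σ x = k}

open Classical in
/-- The colouring after the first `k` stages, where `σ x` is the stage in which the gadget of `x` is
recoloured. -/
noncomputable def stagedColor (H : SimpleGraph ℕ) (l σ : ℕ → ℕ) : ℕ → ℕ → Fin 4
  | 0, _ => 0
  | k + 1, y => if (touching H l σ k y).Nonempty then
      recolor H l (sInf (touching H l σ k y)) (stagedColor H l σ k) y
      else stagedColor H l σ k y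

section Correct

variable {H : SimpleGraph ℕ} {l σ : ℕ → ℕ}

theorem gadget_subset (x : ℕ) : gadget H l x ⊆ layerBall H l 2 x := by
  rw [gadget, pickOrEmpty]
  split_ifs with h
  · exact h.some_mem.2.1
  · exact Set.empty_subset _

/-- `hmono` makes later layers come first, and `hinj` makes gadgets of one stage in one layer
non-interacting. The invariant is that the edge is proper as soon as the stage of its end `w` in the
layer not after that of `y` has passed; the other end need not have had its own stage. -/
theorem stagedColor_ne (hg : ∀ x, (gadgets H l x).Nonempty)
    (hmono : ∀ x y, σ x ≤ σ y → l y ≤ l x)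
    (hinj : ∀ x, ∀ x' ∈ layerBall H l 5 x, σ x = σ x' → x = x') (k : ℕ) {y w : ℕ}
    (hyw : H.Adj y w) (hl : l w ≤ l y) (hk : σ w < k) :
    stagedColor H l σ k y ≠ stagedColor H l σ k w := by
  have hself : ∀ x, x ∈ gadget H l x := fun x => by
    rw [gadget, pickOrEmpty, dif_pos (hg x)]; exact (hg x).some_mem.1
  have hrec : ∀ x c, IsRecoloring H l (gadget H l x) x c (recolor H l x c) := fun x c => by
    refine Classical.epsilon_spec (p := IsRecoloring H l (gadget H l x) x c) ?_
    rw [gadget, pickOrEmpty, dif_pos (hg x)]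
    exact (hg x).some_mem.2.2 c
  have hlay : ∀ x y, y ∈ gadget H l x → l y = l x :=
    fun x y h => layer_eq_of_mem_layerBall (gadget_subset x h)
  induction k with
  | zero => omega
  | succ k ih =>
    rw [stagedColor, stagedColor]
    split_ifs with h1 h2 h2
    · obtain ⟨hy, hσy⟩ := Nat.sInf_mem h1
      obtain ⟨hw, hσw⟩ := Nat.sInf_mem h2
      set x := sInf (touching H l σ k w)
      set x' := sInf (touching H l σ k y)
      have hlx : l x' = l x :=
        le_antisymm (hmono x x' (by omega)) (hmono x' x (by omega))
      -- The centres are linked by 2 steps to `w`, 1 step to `y` and 2 steps back, which is why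
      -- conflicts have radius 5. So both ends are recoloured by the same gadget.
      have hx : x = x' := by
        refine hinj x x' ?_ (hσw.trans hσy.symm)
        have e1 := gadget_subset x hw
        have e2 := mem_layerBall_symm (gadget_subset x' hy)
        have e3 : y ∈ layerBall H l 1 w := mem_layerBall_one hyw.symm (by
          rw [hlay x w hw, hlay x' y hy, hlx])
        exact mem_layerBall_trans e1 (mem_layerBall_trans e3 e2)
      rw [← hx] at hy ⊢
      exact (hrec x _ y hy w hyw (hlay x w hw).ge).1 hw
    · obtain ⟨hy, hσy⟩ := Nat.sInf_mem h1
      set x' := sInf (touching H l σ k y)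
      -- Recolouring `y` once the stage of `w` has been reached forces both ends into the same
      -- layer, so the recolouring takes account of `w`.
      have h3 := hmono w x' (by omega)
      refine (hrec x' _ y hy w hyw ?_).2 fun hw => h2 ⟨x', hw, hσy⟩
      rw [← hlay x' y hy, le_antisymm (by rw [hlay x' y hy]; exact h3) hl]
    · obtain ⟨hw, hσw⟩ := Nat.sInf_mem h2
      set x := sInf (touching H l σ k w)
      refine ((hrec x _ w hw y hyw.symm ?_).2 fun hy => h1 ⟨x, hy, hσw⟩).symm
      rw [← hlay x w hw]
      exact hl
    · refine ih (lt_of_le_of_ne (by omega) fun h => h2 ⟨w, hself w, h⟩)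

end Correct

/-! ### Locality of the staged recolouring. -/

section Locality

variable {l σ : SimpleGraph ℕ → ℕ → ℕ} {t s : ℕ}

/-- The radius increases by 3: two steps to a gadget vertex and one to its neighbour. -/
theorem IsRecoloring.congr (hl : IsLocal t l) (hs : t ≤ s) {H H' : SimpleGraph ℕ} {x : ℕ}
    (hx : LocalEq H H' (s + 3) x) {S : Set ℕ} (hS : S ⊆ layerBall H (l H) 2 x)
    {c c' : ℕ → Fin 4} (hc : ∀ w, LocalEq H H' s w → c w = c' w) {κ : ℕ → Fin 4} :
    IsRecoloring H (l H) S x c κ → IsRecoloring H' (l H') S x c' κ := by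
  intro h y hy w hyw hlw
  have h1 : LocalEq H H' (s + 1) y :=
    (isLocalNbhd_layerBall hl 2 (s + 1) (by omega) H H' x hx).2 y (hS hy)
  have h2 := h1.adj_iff.2 hyw
  have h3 := h1.of_adj h2
  rw [← hc w h3]
  refine h y hy w h2 ?_
  rwa [hl H H' x (hx.mono (by omega)), hl H H' w (h3.mono hs)]

theorem gadgets_congr (hl : IsLocal t l) {H H' : SimpleGraph ℕ} {x : ℕ}
    (hx : LocalEq H H' (t + 3) x) : gadgets H (l H) x = gadgets H' (l H') x := by
  have key : ∀ H H', LocalEq H H' (t + 3) x → gadgets H (l H) x ⊆ gadgets H' (l H') x := by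
    rintro H H' hx S ⟨h1, h2, h3⟩
    refine ⟨h1, ?_, fun c => ?_⟩
    · have e : layerBall H (l H) 2 x = layerBall H' (l H') 2 x :=
        (isLocalNbhd_layerBall hl 2 (t + 1) (by omega) H H' x hx).1
      rwa [← e]
    · obtain ⟨κ, hκ⟩ := h3 c
      exact ⟨κ, hκ.congr hl le_rfl hx h2 fun _ _ => rfl⟩
  exact (key H H' hx).antisymm (key H' H hx.symm)

theorem gadget_congr (hl : IsLocal t l) {H H' : SimpleGraph ℕ} {x : ℕ}
    (hx : LocalEq H H' (t + 3) x) : gadget H (l H) x = gadget H' (l H') x := by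
  rw [gadget, gadgets_congr hl hx, gadget]

/-- The predicates on recolourings are equal, so `Classical.epsilon` makes the same choice; every
vertex of a gadget can thus evaluate a common recolouring. -/
theorem recolor_congr (hl : IsLocal t l) (hs : t ≤ s) {H H' : SimpleGraph ℕ} {x : ℕ}
    (hx : LocalEq H H' (s + 3) x) {c c' : ℕ → Fin 4} (hc : ∀ w, LocalEq H H' s w → c w = c' w) :
    recolor H (l H) x c = recolor H' (l H') x c' := by
  rw [recolor, recolor]
  congr 1
  funext κ
  have hg := gadget_congr hl (hx.mono (t := t + 3) (by omega))
  have h1 := gadget_subset (H := H) (l := l H) x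
  have h2 := gadget_subset (H := H') (l := l H') x
  rw [← hg] at h2 ⊢
  exact propext ⟨fun h => h.congr hl hs hx h1 hc,
    fun h => h.congr hl hs hx.symm h2 fun w hw => (hc w hw.symm).symm⟩

/-- One stage costs radius 5: two steps to the centre of the gadget that contains the vertex, and
three to evaluate its recolouring. -/
theorem isLocal_stagedColor (hl : IsLocal t l) (hs : t ≤ s) (hσ : IsLocal s σ) (k : ℕ) :
    IsLocal (s + k * 5) fun H x => stagedColor H (l H) (σ H) k x := by
  induction k with
  | zero => intro H H' x _; rfl
  | succ k ih =>
    have key : ∀ H H' y, LocalEq H H' (s + k * 5 + 5) y → ∀ x ∈ touching H (l H) (σ H) k y,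
        LocalEq H H' (s + k * 5 + 3) x ∧ x ∈ touching H' (l H') (σ H') k y := by
      rintro H H' y hy x ⟨h1, h2⟩
      have h3 : LocalEq H H' (s + k * 5 + 3) x :=
        (isLocalNbhd_layerBall hl 2 (s + k * 5 + 3) (by omega) H H' y hy).2 x
          (mem_layerBall_symm (gadget_subset x h1))
      refine ⟨h3, ?_, ?_⟩
      · rwa [← gadget_congr hl (h3.mono (by omega))]
      · rw [← h2]
        exact (hσ H H' x (h3.mono (by omega))).symm
    intro H H' y hy
    have hy' : LocalEq H H' (s + k * 5 + 5) y := by rwa [add_assoc, ← Nat.succ_mul]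
    have ht : touching H (l H) (σ H) k y = touching H' (l H') (σ H') k y :=
      Set.Subset.antisymm (fun x hx => (key H H' y hy' x hx).2)
        (fun x hx => (key H' H y hy'.symm x hx).2)
    have h0 : stagedColor H (l H) (σ H) k y = stagedColor H' (l H') (σ H') k y :=
      ih H H' y (hy'.mono (Nat.le_add_right _ _))
    simp only [stagedColor]
    rw [← ht, h0]
    split_ifs with h
    · rw [recolor_congr hl (s := s + k * 5) (by omega)
        (key H H' y hy' _ (Nat.sInf_mem h)).1 fun w hw => ih H H' w hw]
    · rfl

end Locality

/-! ### Existence of gadgets -/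

/-- The four-cycle is 2-choosable. Fix a in the list of vertex 0. If a is missing from the list of
one neighbour, colour greedily around the cycle so that this neighbour comes last; if both
neighbours have a, give it to both of them. -/
theorem exists_two_coloring_four_cycle {α : Type*} [DecidableEq α] (L : Fin 4 → Finset α)
    (hL : ∀ i, 2 ≤ (L i).card) : ∃ k : Fin 4 → α, (∀ i, k i ∈ L i) ∧
      k 0 ≠ k 1 ∧ k 1 ≠ k 2 ∧ k 2 ≠ k 3 ∧ k 3 ≠ k 0 := by
  have pick : ∀ i a, ∃ b ∈ L i, b ≠ a := fun i a => Finset.exists_mem_ne (hL i) a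
  have fin : ∀ a b c d, a ∈ L 0 → b ∈ L 1 → c ∈ L 2 → d ∈ L 3 → a ≠ b → b ≠ c → c ≠ d → d ≠ a →
      ∃ k : Fin 4 → α, (∀ i, k i ∈ L i) ∧ k 0 ≠ k 1 ∧ k 1 ≠ k 2 ∧ k 2 ≠ k 3 ∧ k 3 ≠ k 0 := by
    intro a b c d ha hb hc hd h1 h2 h3 h4
    refine ⟨![a, b, c, d], ?_, h1, h2, h3, h4⟩
    intro i
    fin_cases i
    exacts [ha, hb, hc, hd]
  obtain ⟨a, ha, -⟩ : ∃ a ∈ L 0, True := by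
    obtain ⟨a, ha⟩ := Finset.card_pos.1 (lt_of_lt_of_le two_pos (hL 0))
    exact ⟨a, ha, trivial⟩
  by_cases h3 : a ∈ L 3
  · by_cases h1 : a ∈ L 1
    · obtain ⟨b, hb, hba⟩ := pick 0 a
      obtain ⟨c, hc, hca⟩ := pick 2 a
      exact fin b a c a hb h1 hc h3 hba hca.symm hca hba.symm
    · obtain ⟨d, hd, hda⟩ := pick 3 a
      obtain ⟨c, hc, hcd⟩ := pick 2 d
      obtain ⟨b, hb, hbc⟩ := pick 1 c
      exact fin a b c d ha hb hc hd (fun h => h1 (h ▸ hb)) hbc hcd hda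
  · obtain ⟨b, hb, hba⟩ := pick 1 a
    obtain ⟨c, hc, hcb⟩ := pick 2 b
    obtain ⟨d, hd, hdc⟩ := pick 3 c
    exact fin a b c d ha hb hc hd hba.symm hcb.symm hdc.symm (fun h => h3 (h ▸ hd))

section Gadgets

variable {H : SimpleGraph ℕ} {l : ℕ → ℕ}

/-- At most three constraints leave one of the four colours free. -/
theorem gadgets_nonempty_of_degree_lt (hfin : ∀ x, (H.neighborSet x).Finite) {x : ℕ}
    (hdeg : (H.neighborSet x ∩ {w | l x ≤ l w}).ncard < 4) : (gadgets H l x).Nonempty := by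
  classical
  refine ⟨{x}, rfl, Set.singleton_subset_iff.2 self_mem_layerBall, fun c => ?_⟩
  have hf : (H.neighborSet x ∩ {w | l x ≤ l w}).Finite := (hfin x).inter_of_left _
  obtain ⟨k, hk⟩ : ∃ k, k ∉ hf.toFinset.image c := by
    by_contra! hcon
    have h1 : (hf.toFinset.image c).card = 4 := by
      rw [Finset.eq_univ_iff_forall.2 hcon]; rfl
    have h2 := Finset.card_image_le (s := hf.toFinset) (f := c)
    rw [← Set.ncard_eq_toFinset_card _ hf] at h2
    omega
  refine ⟨fun _ => k, ?_⟩
  rintro y rfl w hyw hlw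
  refine ⟨?_, fun _ h => hk ?_⟩
  · rintro rfl
    exact absurd hyw (H.irrefl)
  · exact Finset.mem_image.2 ⟨w, by simpa using ⟨hyw, hlw⟩, h.symm⟩

/-- Of the at most four neighbours of a cycle vertex in layers not before its own, two are on the
cycle, so at least two colours remain in its list. Triangle-freeness excludes chords, so
2-choosability of the four-cycle finishes the colouring. -/
theorem gadgets_nonempty_of_fourCycle (hfin : ∀ x, (H.neighborSet x).Finite)
    (h3 : H.CliqueFree 3) {v a b c : ℕ} (h : H.IsFourCycle v a b c)
    (hl : l a = l v ∧ l b = l v ∧ l c = l v)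
    (hdeg : ∀ y ∈ [v, a, b, c], (H.neighborSet y ∩ {w | l v ≤ l w}).ncard ≤ 4) :
    (gadgets H l v).Nonempty := by
  classical
  obtain ⟨hla, hlb, hlc⟩ := hl
  refine ⟨{v, a, b, c}, by simp, ?_, fun f => ?_⟩
  · rintro y (rfl | rfl | rfl | rfl)
    · exact self_mem_layerBall
    · exact layerBall_mono one_le_two (mem_layerBall_one h.va hla)
    · exact mem_layerBall_trans (r := 1) (s := 1) (mem_layerBall_one h.va hla)
        (mem_layerBall_one h.ab (hlb.trans hla.symm))
    · exact layerBall_mono one_le_two (mem_layerBall_one h.cv.symm hlc)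
  · have hf : ∀ y, (H.neighborSet y ∩ {w | l v ≤ l w}).Finite :=
      fun y => (hfin y).inter_of_left _
    let L : ℕ → ℕ → ℕ → Finset (Fin 4) := fun y p q =>
      Finset.univ \ (((hf y).toFinset.erase p).erase q).image f
    have hL : ∀ y p q, y ∈ [v, a, b, c] → H.Adj y p → H.Adj y q → l v ≤ l p → l v ≤ l q → q ≠ p →
        2 ≤ (L y p q).card := by
      intro y p q hy hp hq hlp hlq hpq
      have h1 := hdeg y hy
      rw [Set.ncard_eq_toFinset_card _ (hf y)] at h1
      have hp' : p ∈ (hf y).toFinset := by simpa using ⟨hp, hlp⟩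
      have hq' : q ∈ (hf y).toFinset.erase p :=
        Finset.mem_erase.2 ⟨hpq, by simpa using ⟨hq, hlq⟩⟩
      have h2 := Finset.card_erase_of_mem hp'
      have h3 := Finset.card_erase_of_mem hq'
      have h4 := Finset.card_image_le (s := ((hf y).toFinset.erase p).erase q) (f := f)
      have h5 := Finset.le_card_sdiff ((((hf y).toFinset.erase p).erase q).image f)
        (Finset.univ : Finset (Fin 4))
      rw [Finset.card_univ, Fintype.card_fin] at h5
      simp only [L]
      omega
    have hLs : ∀ y p q k w, k ∈ L y p q → H.Adj y w → l v ≤ l w → w ≠ p → w ≠ q → k ≠ f w := by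
      rintro y p q k w hk hw hlw hwp hwq rfl
      refine (Finset.mem_sdiff.1 hk).2 (Finset.mem_image.2 ⟨w, ?_, rfl⟩)
      simp only [Finset.mem_erase]
      exact ⟨hwq, hwp, by simpa using ⟨hw, hlw⟩⟩
    obtain ⟨k, hk, k01, k12, k23, k30⟩ := exists_two_coloring_four_cycle
      ![L v a c, L a v b, L b a c, L c b v] (by
        intro i
        fin_cases i
        · exact hL v a c (by simp) h.va h.cv.symm hla.ge hlc.ge h.ca
        · exact hL a v b (by simp) h.va.symm h.ab le_rfl hlb.ge h.bv
        · exact hL b a c (by simp) h.ab.symm h.bc hla.ge hlc.ge h.ca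
        · exact hL c b v (by simp) h.bc.symm h.cv hlb.ge le_rfl h.bv.symm)
    have hv := h.va.ne
    have hab := h.ab.ne
    have hbc := h.bc.ne
    have hcv := h.cv.ne
    have hbv := h.bv
    have hca := h.ca
    let κ : ℕ → Fin 4 := fun y => if y = v then k 0 else if y = a then k 1 else
      if y = b then k 2 else k 3
    have κv : κ v = k 0 := by simp [κ]
    have κa : κ a = k 1 := by simp [κ, hv.symm]
    have κb : κ b = k 2 := by simp [κ, hbv, hab.symm]
    have κc : κ c = k 3 := by simp [κ, hcv, hca, hbc.symm]
    have nvb : ¬ H.Adj v b := fun h' => h3.not_adj_three h.va h.ab h'.symm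
    have nac : ¬ H.Adj a c := fun h' => h3.not_adj_three h.ab h.bc h'.symm
    have k0 : k 0 ∈ L v a c := hk 0
    have k1 : k 1 ∈ L a v b := hk 1
    have k2 : k 2 ∈ L b a c := hk 2
    have k3 : k 3 ∈ L c b v := hk 3
    refine ⟨κ, ?_⟩
    rintro y (rfl | rfl | rfl | rfl) w hyw hlw
    · refine ⟨?_, fun hw => ?_⟩
      · rintro (rfl | rfl | rfl | rfl)
        · exact absurd hyw H.irrefl
        · rwa [κv, κa]
        · exact absurd hyw nvb
        · rw [κv, κc]; exact k30.symm
      · simp only [Set.mem_insert_iff, Set.mem_singleton_iff, not_or] at hw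
        rw [κv]
        exact hLs _ _ _ _ w k0 hyw hlw hw.2.1 hw.2.2.2
    · refine ⟨?_, fun hw => ?_⟩
      · rintro (rfl | rfl | rfl | rfl)
        · rw [κv, κa]; exact k01.symm
        · exact absurd hyw H.irrefl
        · rwa [κa, κb]
        · exact absurd hyw nac
      · simp only [Set.mem_insert_iff, Set.mem_singleton_iff, not_or] at hw
        rw [κa]
        exact hLs _ _ _ _ w k1 hyw hlw hw.1 hw.2.2.1
    · refine ⟨?_, fun hw => ?_⟩
      · rintro (rfl | rfl | rfl | rfl)
        · exact absurd hyw.symm nvb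
        · rw [κb, κa]; exact k12.symm
        · exact absurd hyw H.irrefl
        · rwa [κb, κc]
      · simp only [Set.mem_insert_iff, Set.mem_singleton_iff, not_or] at hw
        rw [κb]
        exact hLs _ _ _ _ w k2 hyw hlw hw.2.1 hw.2.2.2
    · refine ⟨?_, fun hw => ?_⟩
      · rintro (rfl | rfl | rfl | rfl)
        · rwa [κv, κc]
        · exact absurd hyw.symm nac
        · rw [κb, κc]; exact k23.symm
        · exact absurd hyw H.irrefl
      · simp only [Set.mem_insert_iff, Set.mem_singleton_iff, not_or] at hw
        rw [κc]
        exact hLs _ _ _ _ w k3 hyw hlw hw.2.2.1 hw.1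

end Gadgets

/-! ### The peeling process after relabelling the vertices by their identifiers -/

section Relabel

variable {V : Type*} {G : SimpleGraph V} {ident : V → ℕ}

theorem map_adj_iff_of_injective (hi : Function.Injective ident) {u v : V} :
    (G.map ident).Adj (ident u) (ident v) ↔ G.Adj u v := by
  rw [SimpleGraph.map_adj']
  constructor
  · rintro ⟨-, a, b, h, h1, h2⟩
    rwa [hi h1, hi h2] at h
  · exact fun h => ⟨fun h' => h.ne (hi h'), u, v, h, rfl, rfl⟩

theorem exists_of_map_adj {x y : ℕ} (h : (G.map ident).Adj x y) :
    ∃ u v, ident u = x ∧ ident v = y := by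
  obtain ⟨-, a, b, -, h1, h2⟩ := (SimpleGraph.map_adj' ..).1 h
  exact ⟨a, b, h1, h2⟩

theorem neighborSet_map_finite [Finite V] (x : ℕ) : ((G.map ident).neighborSet x).Finite :=
  (Set.finite_range ident).subset fun y hy => by
    obtain ⟨-, v, -, rfl⟩ := exists_of_map_adj hy
    exact ⟨v, rfl⟩

theorem ncard_neighborSet_map_inter (hi : Function.Injective ident) {A : Set V} {B : Set ℕ}
    (hAB : ∀ v, v ∈ A ↔ ident v ∈ B) (v : V) :
    ((G.map ident).neighborSet (ident v) ∩ B).ncard = (G.neighborSet v ∩ A).ncard := by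
  rw [← Set.ncard_image_of_injective _ hi]
  congr 1
  ext y
  constructor
  · rintro ⟨h1, h2⟩
    obtain ⟨-, u, -, rfl⟩ := exists_of_map_adj h1
    exact ⟨u, ⟨(map_adj_iff_of_injective hi).1 h1, (hAB u).2 h2⟩, rfl⟩
  · rintro ⟨u, ⟨h1, h2⟩, rfl⟩
    exact ⟨(map_adj_iff_of_injective hi).2 h1, (hAB u).1 h2⟩

theorem isFourCycle_map_iff (hi : Function.Injective ident) {v a b c : V} :
    (G.map ident).IsFourCycle (ident v) (ident a) (ident b) (ident c) ↔ G.IsFourCycle v a b c := by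
  have adj := fun u v => map_adj_iff_of_injective (G := G) hi (u := u) (v := v)
  constructor
  · intro h
    exact ⟨(adj _ _).1 h.va, (adj _ _).1 h.ab, (adj _ _).1 h.bc, (adj _ _).1 h.cv,
      fun h' => h.bv (by rw [h']), fun h' => h.ca (by rw [h'])⟩
  · intro h
    exact ⟨(adj _ _).2 h.va, (adj _ _).2 h.ab, (adj _ _).2 h.bc, (adj _ _).2 h.cv,
      fun h' => h.bv (hi h'), fun h' => h.ca (hi h')⟩

theorem onFour_map_iff (hi : Function.Injective ident) {A : Set V} {B : Set ℕ}
    (hAB : ∀ v, v ∈ A ↔ ident v ∈ B) (v : V) :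
    (G.map ident).OnFour B (ident v) ↔ G.OnFour A v := by
  have hn := ncard_neighborSet_map_inter (G := G) hi hAB
  constructor
  · rintro ⟨a, b, c, h, hd⟩
    obtain ⟨-, a, -, rfl⟩ := exists_of_map_adj h.va
    obtain ⟨-, b, -, rfl⟩ := exists_of_map_adj h.ab
    obtain ⟨-, c, -, rfl⟩ := exists_of_map_adj h.bc
    refine ⟨a, b, c, (isFourCycle_map_iff hi).1 h, fun w hw => ?_⟩
    rw [hAB, ← hn]
    refine hd _ ?_
    simpa [hi.eq_iff] using hw
  · rintro ⟨a, b, c, h, hd⟩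
    refine ⟨ident a, ident b, ident c, (isFourCycle_map_iff hi).2 h, ?_⟩
    simp only [List.mem_cons, List.not_mem_nil, or_false, forall_eq_or_imp, forall_eq, hn,
      ← hAB] at hd ⊢
    exact hd

theorem mem_chain_map_iff (hi : Function.Injective ident) (k : ℕ) (v : V) :
    v ∈ G.chain k ↔ ident v ∈ (G.map ident).chain k := by
  induction k generalizing v with
  | zero => exact iff_of_true trivial trivial
  | succ k ih =>
    rw [SimpleGraph.chain, SimpleGraph.chain]
    split_ifs
    · simp only [SimpleGraph.stepOne, Set.mem_ofPred_eq, onFour_map_iff hi ih, ih]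
    · simp only [SimpleGraph.stepTwo, Set.mem_ofPred_eq, ncard_neighborSet_map_inter hi ih, ih]

/-- Naturals that are not identifiers are isolated vertices of the relabelled graph. They disappear
only in the second step, for want of neighbours, whence `2 ≤ k`. -/
theorem chain_map_eq_empty (hi : Function.Injective ident) {k : ℕ} (hk : 2 ≤ k)
    (h : G.chain k = ∅) : (G.map ident).chain k = ∅ := by
  rw [Set.eq_empty_iff_forall_notMem]
  intro x hx
  have h2 := ((G.map ident).chain_antitone hk hx).2
  obtain ⟨y, hy⟩ : ((G.map ident).neighborSet x ∩ (G.map ident).chain 1).Nonempty := by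
    by_contra hcon
    rw [Set.not_nonempty_iff_eq_empty] at hcon
    change 4 ≤ ((G.map ident).neighborSet x ∩ (G.map ident).chain 1).ncard at h2
    rw [hcon, Set.ncard_empty] at h2
    omega
  obtain ⟨v, -, rfl, -⟩ := exists_of_map_adj hy.1
  rw [← mem_chain_map_iff hi, h] at hx
  exact hx

theorem cliqueFree_map (hi : Function.Injective ident) (h3 : G.CliqueFree 3) :
    (G.map ident).CliqueFree 3 := by
  intro s hs
  obtain ⟨a, b, c, hab, hac, hbc, -⟩ := SimpleGraph.is3Clique_iff.1 hs
  obtain ⟨a, b, rfl, rfl⟩ := exists_of_map_adj hab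
  obtain ⟨-, c, -, rfl⟩ := exists_of_map_adj hac
  rw [map_adj_iff_of_injective hi] at hab hac hbc
  exact h3.not_adj_three hab hbc hac.symm

theorem mem_layer_of_mem_chain (h3 : G.CliqueFree 3) {r : ℕ} {v : V} (h1 : v ∈ G.chain r)
    (h2 : v ∉ G.chain (r + 1)) : v ∈ G.layer (r / 2, if r % 2 = 0 then 0 else 1) := by
  obtain ⟨i, rfl | rfl⟩ : ∃ i, r = 2 * i ∨ r = 2 * i + 1 := ⟨r / 2, by omega⟩
  · rw [SimpleGraph.chain_two_mul h3] at h1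
    rw [SimpleGraph.chain_two_mul_add_one h3] at h2
    simpa [SimpleGraph.layer] using ⟨h1, h2⟩
  · rw [SimpleGraph.chain_two_mul_add_one h3] at h1
    rw [show 2 * i + 1 + 1 = 2 * (i + 1) by ring, SimpleGraph.chain_two_mul h3] at h2
    rw [show (2 * i + 1) / 2 = i by omega, if_neg (by omega)]
    simpa [SimpleGraph.layer] using ⟨h1, h2⟩

end Relabel

/-! ### The algorithm -/

/-- The number of colours that schedule the recolourings within a layer. -/
def scheduleColors : ℕ := 5 ^ 5 + 1

/-- The vertices other than `x` within distance five of `x` in its layer. -/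
def conflicts (K : ℕ) (H : SimpleGraph ℕ) (x : ℕ) : Set ℕ :=
  {y | y ∈ layerBall H (peelRank H K) 5 x ∧ y ≠ x}

/-- The stage in which the gadget of `x` is recoloured. -/
noncomputable def recolorStage (K b : ℕ) (H : SimpleGraph ℕ) (x : ℕ) : ℕ :=
  (K - 1 - peelRank H K x) * scheduleColors + bitColor scheduleColors (conflicts K H) b x

/-- The label and the colour of `x`, if there are `K` peeling steps and identifiers of `b` bits. -/
noncomputable def peelOutput (K b : ℕ) (H : SimpleGraph ℕ) (x : ℕ) : (ℕ × Fin 2) × Fin 4 :=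
  ((peelRank H K x / 2, if peelRank H K x % 2 = 0 then 0 else 1),
    stagedColor H (peelRank H K) (recolorStage K b H) (K * scheduleColors) x)

/-- The radius of the neighbourhood that determines the output. -/
def peelRadius (K b : ℕ) : ℕ :=
  3 * K + b * (2 * scheduleColors * 5) + K * scheduleColors * 5

theorem isLocal_peelOutput (K b : ℕ) : IsLocal (peelRadius K b) (peelOutput K b) := by
  have h1 : IsLocal (3 * K) fun H => peelRank H K := isLocal_peelRank K
  have h2 : IsLocalNbhd (3 * K) 5 (conflicts K) := by
    intro s hs H H' x hx
    obtain ⟨h3, h4⟩ := isLocalNbhd_layerBall h1 5 s hs H H' x hx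
    have h3' : layerBall H (peelRank H K) 5 x = layerBall H' (peelRank H' K) 5 x := h3
    exact ⟨by rw [conflicts, h3', conflicts], fun y hy => h4 y hy.1⟩
  have h3 := isLocal_bitColor h2 scheduleColors b
  have h4 : IsLocal (3 * K + b * (2 * scheduleColors * 5)) (recolorStage K b) := by
    intro H H' x hx
    have e1 : peelRank H K x = peelRank H' K x := h1 H H' x (hx.mono (by omega))
    have e2 : bitColor scheduleColors (conflicts K H) b x =
      bitColor scheduleColors (conflicts K H') b x := h3 H H' x hx
    rw [recolorStage, e1, e2, recolorStage]
  intro H H' x hx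
  have e1 : peelRank H K x = peelRank H' K x := h1 H H' x (hx.mono (by unfold peelRadius; omega))
  have e2 : stagedColor H (peelRank H K) (recolorStage K b H) (K * scheduleColors) x =
      stagedColor H' (peelRank H' K) (recolorStage K b H') (K * scheduleColors) x :=
    isLocal_stagedColor h1 (by omega) h4 (K * scheduleColors) H H' x hx
  rw [peelOutput, e1, e2, peelOutput]

/-- Conflicting vertices are not isolated, hence are true identifiers, for which the bound on the
number of bits holds. -/
theorem exists_adj_of_mem_layerBall {H : SimpleGraph ℕ} {l : ℕ → ℕ} {r x y : ℕ}
    (h : y ∈ layerBall H l r x) (hne : y ≠ x) : ∃ u, H.Adj x u := by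
  induction r with
  | zero => exact absurd h hne
  | succ r ih =>
    rcases h with h | ⟨u, h0, -⟩
    · exact ih h
    · exact ⟨u, h0⟩

section Peel

variable {H : SimpleGraph ℕ} {K : ℕ}

/-- An even rank means removal in a first step, which removes the whole light four-cycle, so the
cycle lies in one layer; an odd rank means removal in a second step for low degree. -/
theorem ncard_neighborSet_le_or_of_peelRank (hK : H.chain K = ∅) (x : ℕ) :
    (H.neighborSet x ∩ {w | peelRank H K x ≤ peelRank H K w}).ncard < 4 ∨
    ∃ a b c, H.IsFourCycle x a b c ∧ ∀ y ∈ [x, a, b, c], peelRank H K y = peelRank H K x ∧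
      (H.neighborSet y ∩ {w | peelRank H K x ≤ peelRank H K w}).ncard ≤ 4 := by
  have hset : {w | peelRank H K x ≤ peelRank H K w} = H.chain (peelRank H K x) := by
    ext w; exact (mem_chain_iff_le_peelRank hK _ w).symm
  rw [hset]
  set m := peelRank H K x with hm
  have h1 : x ∈ H.chain m := (mem_chain_iff_le_peelRank hK _ x).2 le_rfl
  have h2 : x ∉ H.chain (m + 1) := by
    rw [mem_chain_iff_le_peelRank hK]; omega
  by_cases hev : Even m
  · right
    rw [SimpleGraph.chain, if_pos hev] at h2
    have h4 : H.OnFour (H.chain m) x := by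
      by_contra hcon; exact h2 ⟨h1, hcon⟩
    have layer : ∀ y, H.OnFour (H.chain m) y → y ∈ H.chain m → peelRank H K y = m := by
      intro y hy hym
      have h5 : y ∉ H.chain (m + 1) := by
        rw [SimpleGraph.chain, if_pos hev]
        exact fun h => h.2 hy
      rw [mem_chain_iff_le_peelRank hK] at h5 hym
      omega
    obtain ⟨a, b, c, h, hd⟩ := h4
    refine ⟨a, b, c, h, fun y hy => ⟨layer y ?_ (hd y hy).1, (hd y hy).2⟩⟩
    simp only [List.mem_cons, List.not_mem_nil, or_false] at hy hd
    rcases hy with rfl | rfl | rfl | rfl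
    · exact ⟨_, _, _, h, fun w hw => hd w (by simpa using hw)⟩
    · refine ⟨_, _, _, h.rotate, fun w hw => hd w ?_⟩
      simp only [List.mem_cons, List.not_mem_nil, or_false] at hw; tauto
    · refine ⟨_, _, _, h.rotate.rotate, fun w hw => hd w ?_⟩
      simp only [List.mem_cons, List.not_mem_nil, or_false] at hw; tauto
    · refine ⟨_, _, _, h.rotate.rotate.rotate, fun w hw => hd w ?_⟩
      simp only [List.mem_cons, List.not_mem_nil, or_false] at hw; tauto
  · left
    rw [SimpleGraph.chain, if_neg hev] at h2
    by_contra hcon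
    exact h2 ⟨h1, not_lt.1 hcon⟩

theorem peelOutput_snd_ne (hK : H.chain K = ∅) (h3 : H.CliqueFree 3)
    (hfin : ∀ x, (H.neighborSet x).Finite) {b : ℕ} (hb : ∀ x y, H.Adj x y → x < 2 ^ b) {x y : ℕ}
    (hxy : H.Adj x y) : (peelOutput K b H x).2 ≠ (peelOutput K b H y).2 := by
  have hg : ∀ x, (gadgets H (peelRank H K) x).Nonempty := by
    intro x
    rcases ncard_neighborSet_le_or_of_peelRank hK x with h | ⟨a, b, c, h, hd⟩
    · exact gadgets_nonempty_of_degree_lt hfin h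
    · exact gadgets_nonempty_of_fourCycle hfin h3 h
        ⟨(hd a (by simp)).1, (hd b (by simp)).1, (hd c (by simp)).1⟩ fun y hy => (hd y hy).2
  have hdeg : ∀ x, {u | H.Adj x u ∧ peelRank H K u = peelRank H K x}.ncard ≤ 4 := by
    intro x
    have hle : {u | H.Adj x u ∧ peelRank H K u = peelRank H K x}.ncard ≤
        (H.neighborSet x ∩ {w | peelRank H K x ≤ peelRank H K w}).ncard :=
      Set.ncard_le_ncard (fun u hu => ⟨hu.1, hu.2.ge⟩) ((hfin x).inter_of_left _)
    rcases ncard_neighborSet_le_or_of_peelRank hK x with h | ⟨a, b, c, h, hd⟩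
    · omega
    · exact hle.trans (hd x (by simp)).2
  have hMpos : 0 < scheduleColors := Nat.succ_pos _
  have hQfin : ∀ x, (conflicts K H x).Finite :=
    fun x => (layerBall_finite hfin 5 x).subset fun y hy => hy.1
  -- A layer ball of radius 5 has at most 5^5 vertices; `scheduleColors` is one more.
  have hQcard : ∀ x, (conflicts K H x).ncard < scheduleColors := fun x =>
    Nat.lt_succ_of_le ((Set.ncard_le_ncard (fun y hy => hy.1) (layerBall_finite hfin 5 x)).trans
      (ncard_layerBall_le hfin hdeg 5 x))
  have hlt : ∀ x, bitColor scheduleColors (conflicts K H) b x < scheduleColors :=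
    bitColor_lt hQfin hQcard hMpos b
  have hrank : ∀ x, peelRank H K x < K := by
    intro x
    by_contra hcon
    have := (mem_chain_iff_le_peelRank hK K x).2 (not_lt.1 hcon)
    rw [hK] at this
    exact this
  have key : ∀ y w, H.Adj y w → peelRank H K w ≤ peelRank H K y →
      (peelOutput K b H y).2 ≠ (peelOutput K b H w).2 := by
    intro y w hyw hl
    refine stagedColor_ne hg ?_ ?_ _ hyw hl ?_
    -- Stages of different layers occupy disjoint blocks of length `scheduleColors`, the block of
    -- the highest rank coming first.
    · intro x y h
      by_contra! hcon
      have h1 := hrank x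
      have h2 := hrank y
      have h3 : (K - 1 - peelRank H K y + 1) * scheduleColors ≤
          (K - 1 - peelRank H K x) * scheduleColors := Nat.mul_le_mul_right _ (by omega)
      rw [Nat.succ_mul] at h3
      have := hlt y
      simp only [recolorStage] at h
      omega
    · intro x x' hx' h
      by_contra hne
      have hadj := exists_adj_of_mem_layerBall hx' (Ne.symm hne)
      have hadj' := exists_adj_of_mem_layerBall (mem_layerBall_symm hx') hne
      simp only [recolorStage, layer_eq_of_mem_layerBall hx', add_right_inj] at h
      refine bitColor_ne hQfin hQcard hMpos ?_ (fun x hx => hx.2 rfl) b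
        (show x' ∈ conflicts K H x from ⟨hx', Ne.symm hne⟩) ?_ h
      · exact fun x y hy => ⟨mem_layerBall_symm hy.1, hy.2.symm⟩
      · obtain ⟨u, hu⟩ := hadj
        obtain ⟨u', hu'⟩ := hadj'
        -- Identifiers below 2^b have no bits above the first b, so after b rounds the bit colouring
        -- separates every conflict.
        rw [Nat.div_eq_of_lt (hb _ _ hu), Nat.div_eq_of_lt (hb _ _ hu')]
    · have h1 := hrank w
      have h2 := hlt w
      have h3 : (K - 1 - peelRank H K w + 1) * scheduleColors ≤ K * scheduleColors :=
        Nat.mul_le_mul_right _ (by omega)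
      rw [Nat.succ_mul] at h3
      simp only [recolorStage]
      omega
  rcases le_total (peelRank H K y) (peelRank H K x) with h | h
  · exact key x y hxy h
  · exact (key y x hxy.symm h).symm

end Peel

/-! ### Running time and assembly of the algorithm. -/

theorem isBigO_peelRadius (c : ℕ) :
    (fun n : ℕ => ((peelRadius (2 * numIterations n) (c * (Nat.log 2 n + 1)) + 1 : ℕ) : ℝ))
      =O[atTop] (fun n : ℕ => Real.log n) := by
  set M : ℝ := ((scheduleColors : ℕ) : ℝ) with hM
  have hM0 : 0 ≤ M := Nat.cast_nonneg _
  -- With y = log₂ n ≥ 1 one has K ≤ 284y and b ≤ 2cy, and the radius is K(3 + 5M) + 10Mb; the final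
  -- 1 absorbs the extra round. Dividing by log 2 converts to the natural logarithm.
  refine IsBigO.of_bound ((284 * (3 + 5 * M) + 20 * M * c + 1) / Real.log 2) ?_
  filter_upwards [eventually_ge_atTop 2] with n hn
  have hn' : (2 : ℝ) ≤ n := by exact_mod_cast hn
  have hlog2 : 0 < Real.log 2 := Real.log_pos (by norm_num)
  set y := Real.logb 2 n with hy
  have hylog : Real.log n = y * Real.log 2 := by
    rw [hy, Real.logb, div_mul_cancel₀ _ hlog2.ne']
  have hy1 : 1 ≤ y := by
    rw [hy, Real.le_logb_iff_rpow_le (by norm_num) (by linarith), Real.rpow_one]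
    exact hn'
  have hceil : (⌈y⌉₊ : ℝ) ≤ y + 1 := (Nat.ceil_lt_add_one (by linarith)).le
  have hnlog : (Nat.log 2 n : ℝ) ≤ y := by
    have := Real.natLog_le_logb n 2
    simpa using this
  rw [Real.norm_of_nonneg (Nat.cast_nonneg _), Real.norm_of_nonneg (by rw [hylog]; positivity),
    hylog, div_mul_eq_mul_div, le_div_iff₀ hlog2]
  simp only [peelRadius, numIterations, ← hy]
  push_cast
  rw [← hM, ← mul_assoc _ y]
  refine mul_le_mul_of_nonneg_right ?_ hlog2.le
  have hc0 : (0 : ℝ) ≤ c := Nat.cast_nonneg c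
  have h1 : 2 * (1 + 70 * (⌈y⌉₊ : ℝ)) ≤ 284 * y := by linarith
  have h2 : (c : ℝ) * (Nat.log 2 n + 1) ≤ c * (2 * y) :=
    mul_le_mul_of_nonneg_left (by linarith) hc0
  have h3 := mul_le_mul_of_nonneg_right h1 (show 0 ≤ 3 + 5 * M by positivity)
  have h4 := mul_le_mul_of_nonneg_right h2 (show 0 ≤ 10 * M by positivity)
  nlinarith

theorem peelOutput_correct (c : ℕ) (hc : 1 ≤ c) {V : Type*} [Fintype V] {G : SimpleGraph V}
    (hG : G.IsPlanar) (h3 : G.CliqueFree 3) {ident : V → ℕ} (hi : Function.Injective ident)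
    (hid : ∀ v, ident v ≤ Fintype.card V ^ c) {K b : ℕ}
    (hK : K = 2 * numIterations (Fintype.card V))
    (hb : b = c * (Nat.log 2 (Fintype.card V) + 1)) :
    (∀ v, v ∈ G.layer (peelOutput K b (G.map ident) (ident v)).1) ∧
    ∀ u v, G.Adj u v → (peelOutput K b (G.map ident) (ident u)).2 ≠
      (peelOutput K b (G.map ident) (ident v)).2 := by
  have hKe : (G.map ident).chain K = ∅ := by
    refine chain_map_eq_empty hi ?_ ?_
    · rw [hK, numIterations]
      omega
    · rw [hK, SimpleGraph.chain_two_mul h3, hG.activeSet_numIterations_eq_empty h3]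
  refine ⟨fun v => ?_, fun u v huv => ?_⟩
  · refine mem_layer_of_mem_chain h3 ?_ ?_ <;>
      rw [mem_chain_map_iff hi, mem_chain_iff_le_peelRank hKe]
    omega
  · refine peelOutput_snd_ne hKe (cliqueFree_map hi h3) neighborSet_map_finite ?_
      ((map_adj_iff_of_injective hi).2 huv)
    intro x y hxy
    obtain ⟨w, -, rfl, -⟩ := exists_of_map_adj hxy
    calc ident w ≤ Fintype.card V ^ c := hid w
      _ < (2 ^ (Nat.log 2 (Fintype.card V) + 1)) ^ c :=
          Nat.pow_lt_pow_left (Nat.lt_pow_succ_log_self one_lt_two _) (by omega)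
      _ = 2 ^ b := by rw [hb, ← pow_mul, mul_comm]


theorem mainTheorem3 (c : ℕ) (hc : 1 ≤ c) :
    ∃ (A : LocalAlgorithm ((ℕ × Fin 2) × Fin 4)) (T : ℕ → ℕ),
      (fun n : ℕ => (T n : ℝ)) =O[atTop] (fun n : ℕ => Real.log n) ∧
      ∀ (V : Type) [Fintype V] (G : SimpleGraph V) [DecidableRel G.Adj],
        G.IsPlanar → G.CliqueFree 3 →
        (∀ i : ℕ, ((G.activeSet (i + 1)).ncard : ℝ) ≤ 0.99 * (G.activeSet i).ncard) ∧
        G.activeSet (numIterations (Fintype.card V)) = ∅ ∧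
        ∀ (ident : V → ℕ) (ports : PortNumbering G), Function.Injective ident →
          (∀ v, 1 ≤ ident v ∧ ident v ≤ Fintype.card V ^ c) →
          (∀ v, v ∈ G.layer (A.outputAfter G ident ports (T (Fintype.card V)) v).1) ∧
          (∀ u v, G.Adj u v →
            (A.outputAfter G ident ports (T (Fintype.card V)) u).2 ≠
              (A.outputAfter G ident ports (T (Fintype.card V)) v).2) := by

  refine ⟨fullInformation fun n => peelOutput (2 * numIterations n) (c * (Nat.log 2 n + 1)),
    fun n => peelRadius (2 * numIterations n) (c * (Nat.log 2 n + 1)) + 1, isBigO_peelRadius c, ?_⟩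
  intro V _ G _ hG h3
  refine ⟨fun i => hG.ncard_activeSet_succ_le h3 i, hG.activeSet_numIterations_eq_empty h3,
    fun ident ports hi hid => ?_⟩
  have hout := outputAfter_fullInformation
    (F := fun n => peelOutput (2 * numIterations n) (c * (Nat.log 2 n + 1))) hi ports
    (isLocal_peelOutput _ _)
  simp only [hout]
  exact peelOutput_correct c hc hG h3 hi (fun v => (hid v).2) rfl rfl
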